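/- Let $S$ be a scheme, $G$ a group scheme over $S$, and $X$ a noetherian $S$-scheme with an action $a\colon G\times_S X\to X$ of $G$. Assume that $X$ is p-flat, that is, the second projection $p_2\colon G\times_S X\to X$ is flat (then $a$ is flat too). Let $\mathcal M$ be a coherent $(G,\mathcal O_X)$-module, that is, a coherent $\mathcal O_X$-module with a $G$-linearization: an isomorphism $\Phi\colon a^*\mathcal M\to p_2^*\mathcal M$ that satisfies the cocycle condition on $G\times_S G\times_S X$. A coherent $(G,\mathcal O_X)$-submodule of $\mathcal M$ is a coherent $\mathcal O_X$-submodule $\mathcal N$ with $\Phi(a^*\mathcal N)=p_2^*\mathcal N$, and a $G$-ideal is a quasi-coherent ideal $\mathcal I$ of $\mathcal O_X$ whose extensions to $\mathcal O_{G\times_S X}$ along $a$ and along $p_2$ agree. For a quasi-coherent ideal $\mathfrak a$ of $\mathcal O_X$ let $\mathfrak a^*$ be the largest $G$-ideal contained in $\mathfrak a$. A $G$-ideal $\mathcal P$ is called $G$-prime if $\mathcal P=\mathfrak p^*$ for some quasi-coherent ideal $\mathfrak p$ whose closed subscheme $V(\mathfrak p)$ is integral. For a $G$-ideal $\mathcal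 I$ put $\sqrt[G]{\mathcal I}=(\bigcap\mathcal P)^*$, where $\mathcal P$ runs over the $G$-primes that contain $\mathcal I$ (and $\sqrt[G]{\mathcal I}=\mathcal O_X$ if there are none). Write $\mathcal N:\mathcal M$ for the ideal of the local sections $f$ of $\mathcal O_X$ with $f\mathcal M\subset\mathcal N$. A coherent $(G,\mathcal O_X)$-submodule $\mathcal N$ of $\mathcal M$ is called $G$-primary if $\mathcal N\ne\mathcal M$ and if, for every coherent $(G,\mathcal O_X)$-submodule $\mathcal L$ of $\mathcal M$ and every $G$-ideal $\mathcal I$ with $\mathcal I\mathcal L\subset\mathcal N$ and $\mathcal L\not\subset\mathcal N$, one has $\mathcal I\subset\sqrt[G]{\mathcal N:\mathcal M}$. Then every coherent $(G,\mathcal O_X)$-submodule $\mathcal N$ of $\mathcal M$ has a minimal $G$-primary decomposition: there are an integer $r\ge 0$ and $G$-primary submodules $\mathcal N_1,\dots,\mathcal N_r$ of $\mathcal M$ such that $$\mathcal N=\mathcal N_1\cap\cdots\cap\mathcal N_r,$$ such that $\bigcap_{j\ne i}\mathcal N_j\ne\mathcal N$ for every $i$, and such that $\sqrt[G]{\mathcal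 N_i:\mathcal M}\ne\sqrt[G]{\mathcal N_j:\mathcal M}$ for all $i\ne j$. (The empty intersection is $\mathcal M$.) -/

import Mathlib

open CategoryTheory Limits MonoidalCategory CartesianMonoidalCategory AlgebraicGeometry

universe u

noncomputable section

namespace GPrimary

/-! ### Group schemes and actions

`G` is a group object of the category `Over S` of `S`-schemes, and `X : Over S` is a `G`-scheme
through Mathlib's `ModObj G X` (an associative and unital action `G ×_S X ⟶ X`). -/

section Action

variable {S : Scheme.{u}} (G X : Over S) [GrpObj G] [ModObj G X]

/-- The action `a : G × X ⟶ X`, as a morphism of `S`-schemes. -/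
def actOver : G ⊗ X ⟶ X := ModObj.smul (M := G) (X := X)

/-- The action `a : G × X ⟶ X`, as a morphism of schemes. -/
def act : (G ⊗ X).left ⟶ X.left := (actOver G X).left

/-- The second projection `p₂ : G × X ⟶ X`. -/
def proj : (G ⊗ X).left ⟶ X.left := (snd G X).left

/-- `μ × 1 : G × G × X ⟶ G × X`. -/
def mulOne : (G ⊗ G ⊗ X).left ⟶ (G ⊗ X).left :=
  ((α_ G G X).inv ≫ MonObj.mul (X := G) ▷ X).left

/-- `1 × a : G × G × X ⟶ G × X`. -/
def oneAct : (G ⊗ G ⊗ X).left ⟶ (G ⊗ X).left := (G ◁ actOver G X).left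

/-- `p₂₃ : G × G × X ⟶ G × X`. -/
def projTail : (G ⊗ G ⊗ X).left ⟶ (G ⊗ X).left := (snd G (G ⊗ X)).left

lemma mulOne_act : mulOne G X ≫ act G X = oneAct G X ≫ act G X := by
  have h : ((α_ G G X).inv ≫ MonObj.mul (X := G) ▷ X) ≫ actOver G X =
      (G ◁ actOver G X) ≫ actOver G X := by
    have := ModObj.mul_smul (M := G) X
    rw [Category.assoc, Iso.inv_comp_eq]
    exact this
  exact congrArg (fun f => f.left) h

lemma oneAct_proj : oneAct G X ≫ proj G X = projTail G X ≫ act G X := by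
  have h : (G ◁ actOver G X) ≫ snd G X = snd G (G ⊗ X) ≫ actOver G X := by simp
  exact congrArg (fun f => f.left) h

/-- `X` is p-flat: the second projection `p₂ : G × X ⟶ X` is flat. -/
def IsPFlat : Prop := Flat (proj G X)

end Action

lemma projTail_proj {S : Scheme.{u}} (G X : Over S) [GrpObj G] : projTail G X ≫ proj G X = mulOne G X ≫ proj G X := by
  have h : snd G (G ⊗ X) ≫ snd G X =
      ((α_ G G X).inv ≫ MonObj.mul (X := G) ▷ X) ≫ snd G X := by simp
  exact congrArg (fun f => f.left) h

/-! ### Linearized modules -/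

/-- The canonical isomorphism `d : f^* g^* M ≅ f'^* g'^* M` for `f ≫ g = f' ≫ g'`. -/
def canIso {W Y Y' Z : Scheme.{u}} {f : W ⟶ Y} {g : Y ⟶ Z} {f' : W ⟶ Y'} {g' : Y' ⟶ Z}
    (h : f ≫ g = f' ≫ g') (M : Z.Modules) :
    (Scheme.Modules.pullback f).obj ((Scheme.Modules.pullback g).obj M) ≅
      (Scheme.Modules.pullback f').obj ((Scheme.Modules.pullback g').obj M) :=
  (Scheme.Modules.pullbackComp f g).app M ≪≫
    (Scheme.Modules.pullbackCongr h).app M ≪≫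
    ((Scheme.Modules.pullbackComp f' g').app M).symm

/-- A sheaf of modules is coherent: quasi-coherent and of finite type. (This is the notion on a
noetherian scheme, the only case where it is used.) -/
def IsCoherent {Y : Scheme.{u}} (M : Y.Modules) : Prop :=
  SheafOfModules.IsQuasicoherent M ∧ SheafOfModules.IsFiniteType M

section Modules

variable {S : Scheme.{u}} (G X : Over S) [GrpObj G] [ModObj G X]

/-- A `G`-linearization of `M`: an isomorphism `Φ : a^* M ≅ p₂^* M` with the cocycle condition
on `G × G × X`. -/
structure Linearization (M : X.left.Modules) where
  /-- the isomorphism `a^* M ≅ p₂^* M` -/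
  iso : (Scheme.Modules.pullback (act G X)).obj M ≅ (Scheme.Modules.pullback (proj G X)).obj M
  cocycle : (Scheme.Modules.pullback (mulOne G X)).map iso.hom =
    (canIso (mulOne_act G X) M).hom ≫
      (Scheme.Modules.pullback (oneAct G X)).map iso.hom ≫
      (canIso (oneAct_proj G X) M).hom ≫
      (Scheme.Modules.pullback (projTail G X)).map iso.hom ≫
      (canIso (projTail_proj G X) M).hom

variable {G X} {M : X.left.Modules}

/-- `N ⊆ M` is stable under `G`: `Φ (a^* N) = p₂^* N`, where `a^* N` and `p₂^* N` are identified
with their images in `a^* M` and `p₂^* M` (`a` and `p₂` are flat in the case of interest). -/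
def IsStable (Φ : Linearization G X M) (N : Subobject M) : Prop :=
  imageSubobject ((Scheme.Modules.pullback (act G X)).map N.arrow ≫ Φ.iso.hom) =
    imageSubobject ((Scheme.Modules.pullback (proj G X)).map N.arrow)

/-- `N` is a coherent `(G, 𝒪_X)`-submodule of `(M, Φ)`. -/
structure IsCohGSubmodule (Φ : Linearization G X M) (N : Subobject M) : Prop where
  coherent : IsCoherent (N : X.left.Modules)
  stable : IsStable Φ N

end Modules

/-! ### Products and colons -/

section Colon

variable {Y : Scheme.{u}} {M : Y.Modules}

/-- The sections of `N ⊆ M` over `U`, as a submodule of the sections of `M` over `U`. -/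
def sections (N : Subobject M) (U : Y.Opens) : Submodule Γ(Y, U) Γ(M, U) where
  carrier := Set.range (fun x : Γ((N : Y.Modules), U) => (N.arrow.app U).hom x)
  add_mem' := by
    rintro _ _ ⟨x, rfl⟩ ⟨y, rfl⟩
    exact ⟨x + y, map_add _ _ _⟩
  zero_mem' := ⟨0, map_zero _⟩
  smul_mem' := by
    rintro r _ ⟨x, rfl⟩
    exact ⟨r • x, Scheme.Modules.Hom.app_smul N.arrow r x⟩

/-- `I L ⊆ N`, for a quasi-coherent ideal `I` of `𝒪_Y` and subsheaves of modules `L`, `N` of `M`: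
it says so on the sections over each affine open set. -/
def MulLE (I : Y.IdealSheafData) (L N : Subobject M) : Prop :=
  ∀ U : Y.affineOpens, I.ideal U • sections L U.1 ≤ sections N U.1

/-- The ideal `N : M` of `𝒪_Y`: the quasi-coherent ideal of the local sections `r` of `𝒪_Y`
with `r M ⊆ N`. -/
def colon (N : Subobject M) : Y.IdealSheafData :=
  Scheme.IdealSheafData.ofIdeals fun U => (sections N U.1).colon Set.univ

end Colon

/-! ### `G`-ideals, `G`-primes and the `G`-radical

Quasi-coherent ideals of `𝒪_X` are Mathlib's `Scheme.IdealSheafData`. -/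

section Ideals

variable {S : Scheme.{u}} (G : Over S) {X : Over S} [GrpObj G] [ModObj G X]

/-- A quasi-coherent `G`-ideal of `𝒪_X`: the extended ideals `I 𝒪_{G × X}` along `a` and along
`p₂` agree; equivalently, `V(I)` has the same inverse image under `a` and `p₂`. -/
def IsGIdeal (I : X.left.IdealSheafData) : Prop :=
  I.comap (act G X) = I.comap (proj G X)

/-- `I^*`: the sum of all quasi-coherent `G`-ideals contained in `I`. -/
def starIdeal (I : X.left.IdealSheafData) : X.left.IdealSheafData :=
  sSup {J | IsGIdeal G J ∧ J ≤ I}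

/-- A `G`-ideal `P` is `G`-prime: `P = p^*` for some ideal `p` with `V(p)` integral, that is,
`V(P)` is `Y^*` for an integral closed subscheme `Y`. -/
def IsGPrime (P : X.left.IdealSheafData) : Prop :=
  IsGIdeal G P ∧ ∃ p : X.left.IdealSheafData, IsIntegral p.subscheme ∧ starIdeal G p = P

/-- The `G`-radical of `I`: `(⋂ P)^*`, over the `G`-primes `P` that contain `I`
(it is `𝒪_X` if there are none). -/
def gRadical (I : X.left.IdealSheafData) : X.left.IdealSheafData :=
  starIdeal G (sInf {P | IsGPrime G P ∧ I ≤ P})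

end Ideals

/-! ### `G`-primary submodules and decompositions -/

section Primary

variable {S : Scheme.{u}} {G X : Over S} [GrpObj G] [ModObj G X] {M : X.left.Modules}

/-- `N` is a `G`-primary submodule of `M`. -/
structure IsGPrimary (Φ : Linearization G X M) (N : Subobject M) : Prop where
  submodule : IsCohGSubmodule Φ N
  ne_top : N ≠ ⊤
  primary : ∀ (L : Subobject M) (I : X.left.IdealSheafData),
    IsCohGSubmodule Φ L → IsGIdeal G I → MulLE I L N → ¬ L ≤ N →
      I ≤ gRadical G (colon N)

/-- `N = N₁ ∩ ⋯ ∩ N_r` is a minimal `G`-primary decomposition. The empty intersection is `M`. -/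
structure IsMinimalGPrimaryDecomposition (Φ : Linearization G X M) (N : Subobject M)
    {r : ℕ} (D : Fin r → Subobject M) : Prop where
  eq_inf : N = Finset.univ.inf D
  primary : ∀ i, IsGPrimary Φ (D i)
  irredundant : ∀ i, (Finset.univ.erase i).inf D ≠ N
  radical_ne : ∀ i j, i ≠ j → gRadical G (colon (D i)) ≠ gRadical G (colon (D j))

end Primary

end GPrimary

end

/-! The argument is that of Lasker and Noether, carried out among the coherent `(G, 𝒪_X)`-submodules
of `M`. Flatness of `p₂`, hence of `a`, makes pullback commute with finite intersections and with
the formation of `N : M`. So stable submodules are closed under intersection and `colon N` is a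
`G`-ideal. As `X` is noetherian, the ascending chain condition holds, and every `N` is a finite
intersection of irreducible submodules.

An irreducible `N ≠ M` is `G`-primary (`isGPrimary_of_irreducible`). Let `I L ⊆ N` and `L ⊄ N`. The
Artin–Rees lemma in `M / N`, on a finite affine cover, gives `m` with `(L + N) ∩ (N + I^m M) = N`.
Both terms are coherent and stable and `L + N ≠ N`, so `I^m M ⊆ N`. A `G`-prime `p^*` that contains
`I^m` contains `I`, because `V(p)` is integral and `I` is a `G`-ideal; hence `I` lies in the
`G`-radical of `N : M`. Two components with equal radicals can be replaced by their intersection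
(`IsGPrimary.inf`), so a decomposition with the fewest components is minimal.

The rest turns sheaves into algebra. Subobjects are compared through their sections over affine
opens, and a family of submodules compatible with localization defines a quasi-coherent subobject
(`IsQCFamily.toSubobject`). Over affine opens the sections of `f^* M` are the extension of scalars
of those of `M` (`isExtension_pullSec`). Stability thereby becomes an equality of spans
(`isStable_iff`), to which commutative algebra over flat ring maps applies. -/

noncomputable section

namespace GPrimary

/-! ### Restriction of sections -/

section Restriction

open TopologicalSpace

variable {X : Scheme.{u}}

/-- Restriction of functions. -/
def resO {U V : X.Opens} (h : V ≤ U) : Γ(X, U) →+* Γ(X, V) :=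
  (X.presheaf.map (homOfLE h).op).hom

/-- Restriction of sections of a sheaf of modules. -/
def res (M : X.Modules) {U V : X.Opens} (h : V ≤ U) : Γ(M, U) →+ Γ(M, V) :=
  (M.presheaf.map (homOfLE h).op).hom

/-- A morphism of sheaves of modules on the sections over an open set. -/
def appL {M N : X.Modules} (φ : M ⟶ N) (U : X.Opens) : Γ(M, U) →ₗ[Γ(X, U)] Γ(N, U) where
  toFun x := (φ.app U).hom x
  map_add' := map_add _
  map_smul' r x := Scheme.Modules.Hom.app_smul φ r x

variable {M N K : X.Modules} {U V W : X.Opens}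

lemma resO_resO (h : V ≤ U) (h' : W ≤ V) (r : Γ(X, U)) :
    resO h' (resO h r) = resO (h'.trans h) r := by
  simp only [resO, ← CommRingCat.comp_apply, ← Functor.map_comp]
  rfl

@[simp]
lemma resO_self (r : Γ(X, U)) : resO le_rfl r = r := by
  simp [resO]

lemma res_res (h : V ≤ U) (h' : W ≤ V) (s : Γ(M, U)) :
    res M h' (res M h s) = res M (h'.trans h) s := by
  simp only [res]
  rw [← ConcreteCategory.comp_apply, ← Functor.map_comp]
  rfl

@[simp]
lemma res_self (s : Γ(M, U)) : res M le_rfl s = s := by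
  simp [res]

lemma res_smul (h : V ≤ U) (r : Γ(X, U)) (s : Γ(M, U)) :
    res M h (r • s) = resO h r • res M h s :=
  Scheme.Modules.map_smul M (homOfLE h) r s

lemma appL_res (φ : M ⟶ N) (h : V ≤ U) (s : Γ(M, U)) :
    appL φ V (res M h s) = res N h (appL φ U s) :=
  congr($(φ.mapPresheaf.naturality (homOfLE h).op) s)

lemma appL_comp (φ : M ⟶ N) (ψ : N ⟶ K) (s : Γ(M, U)) :
    appL (φ ≫ ψ) U s = appL ψ U (appL φ U s) := rfl

lemma hom_ext_appL {φ ψ : M ⟶ N} (h : ∀ U s, appL φ U s = appL ψ U s) : φ = ψ := by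
  ext U s
  exact h U s

/-- Sections that agree locally agree. -/
lemma section_ext {s t : Γ(M, U)}
    (h : ∀ x ∈ U, ∃ (V : X.Opens) (hV : V ≤ U), x ∈ V ∧ res M hV s = res M hV t) : s = t := by
  choose V hV hx e using h
  refine TopCat.Sheaf.eq_of_locally_eq' ⟨_, M.isSheaf⟩ (fun x : U ↦ V x.1 x.2) U
    (fun x ↦ homOfLE (hV x.1 x.2)) (fun x hxU ↦ Opens.mem_iSup.2 ⟨⟨x, hxU⟩, hx x hxU⟩) s t
    (fun x ↦ e x.1 x.2)

/-- Compatible local sections glue. -/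
lemma exists_glue {ι : Type u} (V : ι → X.Opens) (hV : ∀ i, V i ≤ U)
    (hU : ∀ x ∈ U, ∃ i, x ∈ V i) (s : ∀ i, Γ(M, V i))
    (hs : ∀ i j, res M inf_le_left (s i) = res M (inf_le_right : V i ⊓ V j ≤ V j) (s j)) :
    ∃ t : Γ(M, U), ∀ i, res M (hV i) t = s i := by
  obtain ⟨t, ht, -⟩ := TopCat.Sheaf.existsUnique_gluing' ⟨_, M.isSheaf⟩ V U
    (fun i ↦ homOfLE (hV i)) (fun x hx ↦ Opens.mem_iSup.2 (hU x hx)) s (fun i j ↦ hs i j)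
  exact ⟨t, ht⟩

lemma exists_affine_le {x : X} (hx : x ∈ U) :
    ∃ V : X.affineOpens, x ∈ V.1 ∧ V.1 ≤ U := by
  obtain ⟨V, hV, hxV, hVU⟩ := exists_isAffineOpen_mem_and_subset hx
  exact ⟨⟨V, hV⟩, hxV, hVU⟩

lemma isUnit_resO_basicOpen (f : Γ(X, U)) : IsUnit (resO (X.basicOpen_le f) f) :=
  RingedSpace.isUnit_res_basicOpen _ f

/-- A section of a module over `D(f)` is divisible by powers of `f`. -/
lemma smul_pow_injective (hV : V ≤ U) (f : Γ(X, U)) (hf : V ≤ X.basicOpen f) (n : ℕ)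
    {s t : Γ(M, V)} (h : resO hV f ^ n • s = resO hV f ^ n • t) : s = t := by
  have : IsUnit (resO hV f ^ n) := by
    rw [← resO_resO (X.basicOpen_le f) hf]
    exact ((isUnit_resO_basicOpen f).map _).pow n
  exact this.smul_left_cancel.1 h

end Restriction

/-! ### Sections of quasi-coherent modules over affine opens -/

section QC

variable {X : Scheme.{u}}

/-- The sections over affine open sets localize. -/
structure Localizes (M : X.Modules) : Prop where
  exists_pow : ∀ (U : X.affineOpens) (f : Γ(X, U)) (s : Γ(M, X.basicOpen f)),
    ∃ (n : ℕ) (t : Γ(M, U)), res M (X.basicOpen_le f) t = resO (X.basicOpen_le f) f ^ n • s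
  exists_pow_zero : ∀ (U : X.affineOpens) (f : Γ(X, U)) (t : Γ(M, U)),
    res M (X.basicOpen_le f) t = 0 → ∃ n : ℕ, f ^ n • t = 0

lemma fromSpec_image_le {U : X.Opens} (hU : IsAffineOpen U) (T : (Spec Γ(X, U)).Opens) :
    hU.fromSpec ''ᵁ T ≤ U := by
  rintro _ ⟨x, -, rfl⟩
  exact hU.opensRange_fromSpec.le ⟨x, rfl⟩

lemma fromSpec_image_top {U : X.Opens} (hU : IsAffineOpen U) : hU.fromSpec ''ᵁ ⊤ = U := by
  rw [Scheme.Hom.image_top_eq_opensRange, hU.opensRange_fromSpec]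

lemma appIso_inv_fromSpec {U : X.Opens} (hU : IsAffineOpen U) (T : (Spec Γ(X, U)).Opens)
    (r : Γ(X, U)) :
    (hU.fromSpec.appIso T).inv ((Spec Γ(X, U)).presheaf.map T.leTop.op
      ((Scheme.ΓSpecIso Γ(X, U)).inv r)) = resO (fromSpec_image_le hU T) r := by
  have h := fromSpec_image_le hU T
  have e : (Scheme.ΓSpecIso Γ(X, U)).inv ≫ (Spec Γ(X, U)).presheaf.map T.leTop.op =
      X.presheaf.map (homOfLE h).op ≫ (hU.fromSpec.appIso T).hom := by
    rw [Scheme.Hom.appIso_hom', Scheme.Hom.map_appLE]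
    rw [Scheme.Hom.appLE, hU.fromSpec_app_self, Category.assoc, ← Functor.map_comp]
    rfl
  have := congr($(e) r)
  simp only [CommRingCat.comp_apply] at this
  rw [this]
  exact congr($((hU.fromSpec.appIso T).hom_inv_id) _)

lemma restrict_fromSpec_smul (M : X.Modules) {U : X.Opens} (hU : IsAffineOpen U)
    (T : (Spec Γ(X, U)).Opens) (r : Γ(X, U)) (s : Γ(M, hU.fromSpec ''ᵁ T)) :
    (r • (show Γ(M.restrict hU.fromSpec, T) from s) : Γ(M.restrict hU.fromSpec, T)) =
      (resO (fromSpec_image_le hU T) r • s :) := by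
  rw [Scheme.Modules.smul_Spec_def, ← appIso_inv_fromSpec]
  rfl

/-- Bridge between the criterion for quasi-coherence on `Spec` and fractions of sections on `X`
itself, which later arguments manipulate directly. -/
lemma isLocalizing_restrict_iff (M : X.Modules) {U : X.Opens} (hU : IsAffineOpen U) :
    IsLocalizing (modulesSpecToSheaf.obj (M.restrict hU.fromSpec)) ↔
    ∀ f : Γ(X, U), (∀ s : Γ(M, X.basicOpen f), ∃ (n : ℕ) (t : Γ(M, U)),
        res M (X.basicOpen_le f) t = resO (X.basicOpen_le f) f ^ n • s) ∧
      ∀ t : Γ(M, U), res M (X.basicOpen_le f) t = 0 → ∃ n : ℕ, f ^ n • t = 0 := by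
  refine forall_congr' fun f ↦ ?_
  -- The image of `⊤` under `fromSpec` equals `U` only propositionally. With both opens as variables
  -- these equalities can be substituted.
  have key : ∀ (V : X.Opens) (hV : V ≤ U) (W : X.Opens) (hW : W ≤ V)
    (hV' : hU.fromSpec ''ᵁ ⊤ = V) (hW' : hU.fromSpec ''ᵁ (PrimeSpectrum.basicOpen f) = W),
     IsLocalizedModule (.powers f) ((modulesSpecToSheaf.obj (M.restrict hU.fromSpec)).obj.map
      (PrimeSpectrum.basicOpen f).leTop.op).hom ↔
      (∀ s : Γ(M, W), ∃ (n : ℕ) (t : Γ(M, V)),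
        res M hW t = resO (hW.trans hV) f ^ n • s) ∧
      ∀ t : Γ(M, V), res M hW t = 0 → ∃ n : ℕ, resO hV f ^ n • t = 0 := by
    rintro V hV W hW rfl rfl
    constructor
    · intro H
      refine ⟨fun s ↦ ?_, fun t ht ↦ ?_⟩
      · obtain ⟨⟨t, ⟨_, n, rfl⟩⟩, h⟩ := H.surj s
        refine ⟨n, t, h.symm.trans ?_⟩
        rw [← map_pow]
        exact restrict_fromSpec_smul M hU _ (f ^ n) s
      · obtain ⟨⟨_, n, rfl⟩, h⟩ := (IsLocalizedModule.eq_zero_iff (.powers f)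
          ((modulesSpecToSheaf.obj (M.restrict hU.fromSpec)).obj.map
            (PrimeSpectrum.basicOpen f).leTop.op).hom).1 ht
        refine ⟨n, ?_⟩
        rw [← map_pow]
        exact (restrict_fromSpec_smul M hU _ (f ^ n) t).symm.trans h
    · rintro ⟨h₁, h₂⟩
      refine IsLocalizedModule.Away.mk_of_addCommGroup ?_ ?_ ?_
      · exact (M.restrict hU.fromSpec).isUnit_algebraMap_end_of_le_basicOpen f le_rfl
      · intro s
        obtain ⟨n, t, h⟩ := h₁ s
        refine ⟨n, t, ?_⟩
        rw [← map_pow] at h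
        exact (restrict_fromSpec_smul M hU _ (f ^ n) s).trans h.symm
      · intro t ht
        obtain ⟨n, h⟩ := h₂ t ht
        refine ⟨n, ?_⟩
        rw [← map_pow] at h
        exact (restrict_fromSpec_smul M hU _ (f ^ n) t).trans h
  simpa using key U le_rfl _ (X.basicOpen_le f) (fromSpec_image_top hU)
    (hU.fromSpec_image_basicOpen f)

lemma localizes_iff_isLocalizing (M : X.Modules) : Localizes M ↔
    ∀ (U : X.Opens) (hU : IsAffineOpen U),
      IsLocalizing (modulesSpecToSheaf.obj (M.restrict hU.fromSpec)) := by
  simp only [isLocalizing_restrict_iff]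
  exact ⟨fun h U hU f ↦ ⟨h.1 ⟨U, hU⟩ f, h.2 ⟨U, hU⟩ f⟩,
    fun h ↦ ⟨fun U f ↦ (h U U.2 f).1, fun U f ↦ (h U U.2 f).2⟩⟩

lemma localizes_of_isQuasicoherent (M : X.Modules)
    (hM : M.IsQuasicoherent) : Localizes M := by
  rw [localizes_iff_isLocalizing]
  intro U hU
  rw [← isIso_fromTildeΓ_iff_isLocalizing, ← isQuasicoherent_iff_isIso_fromTildeΓ]
  infer_instance

end QC

/-! ### Quasi-coherent subsheaves as families of submodules on affine opens -/

section Families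

open TopologicalSpace

variable {X : Scheme.{u}} {M : X.Modules}

/-- A family of submodules of the sections over affine opens that is compatible with
localization. -/
structure IsQCFamily (P : ∀ U : X.affineOpens, Submodule Γ(X, U) Γ(M, U)) : Prop where
  res_mem : ∀ (U : X.affineOpens) (f : Γ(X, U)) (t : Γ(M, U)), t ∈ P U →
    res M (X.basicOpen_le f) t ∈ P (X.affineBasicOpen f)
  exists_pow : ∀ (U : X.affineOpens) (f : Γ(X, U)) (s : Γ(M, X.basicOpen f)),
    s ∈ P (X.affineBasicOpen f) → ∃ (n : ℕ) (t : Γ(M, U)), t ∈ P U ∧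
      res M (X.basicOpen_le f) t = resO (X.basicOpen_le f) f ^ n • s

lemma mem_family_congr (P : ∀ U : X.affineOpens, Submodule Γ(X, U) Γ(M, U)) {U : X.Opens}
    {V V' : X.affineOpens} (e : V.1 = V'.1) (h : V.1 ≤ U) (h' : V'.1 ≤ U) (s : Γ(M, U)) :
    res M h s ∈ P V ↔ res M h' s ∈ P V' := by
  obtain rfl : V = V' := Subtype.ext e
  rfl

/-- The ideal `J` of all `r` with `r s ∈ Q` contains a power of each given `f`. These `f` generate
the unit ideal, so `J` is the unit ideal. Nothing is asked of `Q` beyond being a submodule. -/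
lemma mem_of_locally_basicOpen (hM : Localizes M) {U : X.affineOpens}
    (Q : Submodule Γ(X, U) Γ(M, U)) (s : Γ(M, U))
    (h : ∀ x ∈ U.1, ∃ f : Γ(X, U), x ∈ X.basicOpen f ∧ ∃ t ∈ Q, ∃ n : ℕ,
      res M (X.basicOpen_le f) t = resO (X.basicOpen_le f) f ^ n • res M (X.basicOpen_le f) s) :
    s ∈ Q := by
  let J : Ideal Γ(X, U) := Q.comap (LinearMap.toSpanSingleton Γ(X, U) Γ(M, U) s)
  have hJ : ∀ r, r ∈ J ↔ r • s ∈ Q := fun r ↦ Iff.rfl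
  let S : Set Γ(X, U) := {f | f ∈ J.radical}
  have hS : Ideal.span S = ⊤ := by
    rw [← U.2.self_le_iSup_basicOpen_iff]
    intro x hx
    obtain ⟨f, hxf, t, ht, n, e⟩ := h x hx
    refine Opens.mem_iSup.2 ⟨⟨f, ?_⟩, hxf⟩
    rw [← map_pow, ← res_smul, ← sub_eq_zero, ← map_sub] at e
    -- Multiplication by `f ^ m` lifts the equality from `D(f)` to `U`, so `f ^ (m + n)` lies in
    -- `J`.
    obtain ⟨m, hm⟩ := hM.exists_pow_zero U f _ e
    refine ⟨m + n, ?_⟩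
    rw [hJ, pow_add, mul_smul, ← sub_eq_zero.1 ((smul_sub _ _ _).symm.trans hm)]
    exact Q.smul_mem _ ht
  have hJ' : J.radical = ⊤ := top_le_iff.1 (hS ▸ Ideal.span_le.2 fun _ h ↦ h)
  have := (Ideal.eq_top_iff_one _).1 (Ideal.radical_eq_top.1 hJ')
  simpa [hJ] using this

namespace IsQCFamily

variable {P : ∀ U : X.affineOpens, Submodule Γ(X, U) Γ(M, U)}

lemma mem_of_basicOpen (hM : Localizes M) (hP : IsQCFamily P) {U : X.affineOpens} (s : Γ(M, U))
    (h : ∀ x ∈ U.1, ∃ f : Γ(X, U), x ∈ X.basicOpen f ∧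
      res M (X.basicOpen_le f) s ∈ P (X.affineBasicOpen f)) : s ∈ P U := by
  refine mem_of_locally_basicOpen hM (P U) s fun x hx ↦ ?_
  obtain ⟨f, hxf, hf⟩ := h x hx
  obtain ⟨n, t, ht, e⟩ := hP.exists_pow U f _ hf
  exact ⟨f, hxf, t, ht, n, e⟩

/-- The axioms speak only of basic opens of one affine open. The opens that are basic in `U` and in
`V` at once cover `V`, which gives arbitrary inclusions. -/
lemma res_mem' (hM : Localizes M) (hP : IsQCFamily P) {U V : X.affineOpens} (h : V.1 ≤ U.1)
    {t : Γ(M, U)} (ht : t ∈ P U) : res M h t ∈ P V := by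
  refine hP.mem_of_basicOpen hM _ fun x hx ↦ ?_
  obtain ⟨g, f, e, hxg⟩ := exists_basicOpen_le_affine_inter U.2 V.2 x ⟨h hx, hx⟩
  refine ⟨f, e ▸ hxg, ?_⟩
  rw [res_res]
  exact (mem_family_congr P e (X.basicOpen_le g) _ t).1 (hP.res_mem U g t ht)

lemma mem_of_locally (hM : Localizes M) (hP : IsQCFamily P) {U : X.affineOpens} (s : Γ(M, U))
    (h : ∀ x ∈ U.1, ∃ (V : X.affineOpens) (hV : V.1 ≤ U.1), x ∈ V.1 ∧ res M hV s ∈ P V) :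
    s ∈ P U := by
  refine hP.mem_of_basicOpen hM _ fun x hx ↦ ?_
  obtain ⟨V, hV, hxV, hs⟩ := h x hx
  obtain ⟨f, g, e, hxf⟩ := exists_basicOpen_le_affine_inter U.2 V.2 x ⟨hx, hxV⟩
  refine ⟨f, hxf, ?_⟩
  have := hP.res_mem V g _ hs
  rw [res_res] at this
  exact (mem_family_congr P e (X.basicOpen_le f) _ s).2 this

/-- The sections over any open set that lie in the family locally. -/
def carrier (_ : Localizes M) (_ : IsQCFamily P) (T : X.Opens) : Submodule Γ(X, T) Γ(M, T) where
  carrier := {s | ∀ (V : X.affineOpens) (h : V.1 ≤ T), res M h s ∈ P V}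
  add_mem' h h' V hV := by
    rw [map_add]
    exact add_mem (h V hV) (h' V hV)
  zero_mem' V hV := by
    rw [map_zero]
    exact zero_mem _
  smul_mem' r s h V hV := by
    rw [res_smul]
    exact Submodule.smul_mem _ _ (h V hV)

lemma mem_carrier_affine (hM : Localizes M) (hP : IsQCFamily P) (U : X.affineOpens)
    (s : Γ(M, U)) : s ∈ hP.carrier hM U.1 ↔ s ∈ P U :=
  ⟨fun h ↦ by simpa using h U le_rfl, fun h V hV ↦ hP.res_mem' hM hV h⟩

lemma res_mem_carrier (hM : Localizes M) (hP : IsQCFamily P) {T T' : X.Opens} (h : T' ≤ T)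
    {s : Γ(M, T)} (hs : s ∈ hP.carrier hM T) : res M h s ∈ hP.carrier hM T' := by
  intro V hV
  rw [res_res]
  exact hs V _

lemma mem_carrier_of_locally (hM : Localizes M) (hP : IsQCFamily P) {T : X.Opens} (s : Γ(M, T))
    (h : ∀ x ∈ T, ∃ (V : X.Opens) (hV : V ≤ T), x ∈ V ∧ res M hV s ∈ hP.carrier hM V) :
    s ∈ hP.carrier hM T := by
  intro U hU
  refine hP.mem_of_locally hM _ fun x hx ↦ ?_
  obtain ⟨V, hV, hxV, hs⟩ := h x (hU hx)
  obtain ⟨W, hxW, hW⟩ := exists_affine_le (U := U.1 ⊓ V) ⟨hx, hxV⟩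
  refine ⟨W, hW.trans inf_le_left, hxW, ?_⟩
  have := hs W (hW.trans inf_le_right)
  rw [res_res] at this ⊢
  exact this

/-- The subpresheaf of modules defined by the family. -/
def toPresheafSubmodule (hM : Localizes M) (hP : IsQCFamily P) :
    PresheafOfModules.Submodule M.val where
  obj T := hP.carrier hM T.unop
  map f _ hs := hP.res_mem_carrier hM f.unop.le hs

/-- Sections glue in `M`, and membership in the family is local, so the glued section stays in the
subpresheaf. -/
lemma isSheaf (hM : Localizes M) (hP : IsQCFamily P) :
    Presheaf.IsSheaf (Opens.grothendieckTopology X)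
      (hP.toPresheafSubmodule hM).toPresheafOfModules.presheaf := by
  refine (TopCat.Presheaf.isSheaf_iff_isSheaf_comp (forget AddCommGrpCat) _).2 ?_
  refine TopCat.Presheaf.isSheaf_of_isSheafUniqueGluing_types _ ?_
  intro ι V s hs
  have hs' : ∀ i j, res M inf_le_left (s i).1 = res M (inf_le_right : V i ⊓ V j ≤ V j) (s j).1 :=
    fun i j ↦ congrArg Subtype.val (hs i j)
  obtain ⟨t, ht⟩ := exists_glue (M := M) (U := iSup V) V (le_iSup V)
    (fun x hx ↦ Opens.mem_iSup.1 hx) (fun i ↦ (s i).1) hs'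
  refine ⟨⟨t, ?_⟩, ?_, ?_⟩
  · refine hP.mem_carrier_of_locally hM t fun x hx ↦ ?_
    obtain ⟨i, hi⟩ := Opens.mem_iSup.1 hx
    refine ⟨V i, le_iSup V i, hi, ?_⟩
    rw [ht]
    exact (s i).2
  · intro i
    exact Subtype.ext (ht i)
  · intro t' ht'
    refine Subtype.ext (section_ext fun x hx ↦ ?_)
    obtain ⟨i, hi⟩ := Opens.mem_iSup.1 hx
    refine ⟨V i, le_iSup V i, hi, ?_⟩
    exact (congrArg Subtype.val (ht' i)).trans (ht i).symm

/-- The quasi-coherent subsheaf defined by the family. -/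
def toModules (hM : Localizes M) (hP : IsQCFamily P) : X.Modules where
  val := (hP.toPresheafSubmodule hM).toPresheafOfModules
  isSheaf := hP.isSheaf hM

/-- The inclusion of the subsheaf. -/
def incl (hM : Localizes M) (hP : IsQCFamily P) : hP.toModules hM ⟶ M :=
  ⟨(hP.toPresheafSubmodule hM).ι⟩

lemma range_incl (hM : Localizes M) (hP : IsQCFamily P) (T : X.Opens) :
    LinearMap.range (appL (hP.incl hM) T) = hP.carrier hM T := by
  ext s
  exact ⟨by rintro ⟨t, rfl⟩; exact t.2, fun h ↦ ⟨⟨s, h⟩, rfl⟩⟩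

end IsQCFamily

end Families

/-! ### Subobjects and their sections -/

section Subobjects

open TopologicalSpace

variable {X : Scheme.{u}} {M : X.Modules}

lemma appL_injective {K : X.Modules} (φ : K ⟶ M) [Mono φ] (U : X.Opens) :
    Function.Injective (appL φ U) := by
  have h₁ : Mono ((Scheme.Modules.toPresheaf X).map φ) := inferInstance
  have h₂ := (NatTrans.mono_iff_mono_app _).1 h₁ (Opposite.op U)
  exact (AddCommGrpCat.mono_iff_injective _).1 h₂

lemma mono_of_appL_injective {K : X.Modules} (φ : K ⟶ M)
    (h : ∀ U, Function.Injective (appL φ U)) : Mono φ := by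
  refine (Scheme.Modules.toPresheaf X).mono_of_mono_map ?_
  refine (NatTrans.mono_iff_mono_app _).2 fun U ↦ ?_
  exact (AddCommGrpCat.mono_iff_injective _).2 (h U.unop)

lemma sections_eq_range (N : Subobject M) (U : X.Opens) :
    sections N U = LinearMap.range (appL N.arrow U) := rfl

lemma sections_mk {K : X.Modules} (i : K ⟶ M) [Mono i] (U : X.Opens) :
    sections (Subobject.mk i) U = LinearMap.range (appL i U) := by
  rw [sections_eq_range]
  refine le_antisymm ?_ ?_
  · rintro _ ⟨s, rfl⟩
    refine ⟨appL (Subobject.underlyingIso i).hom U s, ?_⟩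
    rw [← appL_comp, Subobject.underlyingIso_hom_comp_eq_mk]
  · rintro _ ⟨s, rfl⟩
    refine ⟨appL (Subobject.underlyingIso i).inv U s, ?_⟩
    rw [← appL_comp, Subobject.underlyingIso_arrow]

lemma res_mem_sections (N : Subobject M) {U V : X.Opens} (h : V ≤ U) {s : Γ(M, U)}
    (hs : s ∈ sections N U) : res M h s ∈ sections N V := by
  obtain ⟨t, rfl⟩ := hs
  exact ⟨res _ h t, appL_res N.arrow h t⟩

/-- The local preimages are unique because `N.arrow` is injective on sections. Hence they agree on
overlaps and glue. -/
lemma mem_sections_of_locally (N : Subobject M) {U : X.Opens} (s : Γ(M, U))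
    (h : ∀ x ∈ U, ∃ (V : X.Opens) (hV : V ≤ U), x ∈ V ∧ res M hV s ∈ sections N V) :
    s ∈ sections N U := by
  choose V hV hx t ht using h
  replace ht : ∀ x hx, appL N.arrow (V x hx) (t x hx) = res M (hV x hx) s := ht
  obtain ⟨t', ht'⟩ := exists_glue (M := (N : X.Modules)) (fun x : U ↦ V x.1 x.2)
    (fun x ↦ hV x.1 x.2) (fun x hxU ↦ ⟨⟨x, hxU⟩, hx x hxU⟩) (fun x ↦ t x.1 x.2) (by
      intro i j
      apply appL_injective N.arrow
      rw [appL_res, appL_res, ht, ht, res_res, res_res])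
  refine ⟨t', section_ext fun x hxU ↦ ⟨V x hxU, hV x hxU, hx x hxU, ?_⟩⟩
  rw [← ht x hxU]
  exact (appL_res N.arrow (hV x hxU) t').symm.trans (congrArg _ (ht' ⟨x, hxU⟩))

/-- In an abelian category a monomorphism is the kernel of its cokernel. So it suffices that `φ`
dies in the cokernel of `N`, which can be tested on sections. -/
lemma factors_iff_range_le {K : X.Modules} (φ : K ⟶ M) (N : Subobject M) :
    N.Factors φ ↔ ∀ U, LinearMap.range (appL φ U) ≤ sections N U := by
  constructor
  · intro h U
    rintro _ ⟨s, rfl⟩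
    refine ⟨appL (N.factorThru φ h) U s, ?_⟩
    conv_rhs => rw [← Subobject.factorThru_arrow N φ h]
    rfl
  · intro h
    have h0 : φ ≫ cokernel.π N.arrow = 0 := by
      refine hom_ext_appL fun U s ↦ ?_
      obtain ⟨t, ht⟩ := h U ⟨s, rfl⟩
      rw [appL_comp, ← ht]
      change appL (N.arrow ≫ cokernel.π N.arrow) U t = _
      rw [cokernel.condition]
      rfl
    have : Mono N.arrow := inferInstance
    exact (Subobject.factors_iff _ _).2
      ⟨Abelian.monoLift N.arrow φ h0, Abelian.monoLift_comp N.arrow φ h0⟩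

lemma range_le_sections_of_affine {K : X.Modules} (φ : K ⟶ M) (N : Subobject M)
    (h : ∀ U : X.affineOpens, LinearMap.range (appL φ U.1) ≤ sections N U.1) (T : X.Opens) :
    LinearMap.range (appL φ T) ≤ sections N T := by
  rintro _ ⟨s, rfl⟩
  refine mem_sections_of_locally N _ fun x hx ↦ ?_
  obtain ⟨V, hxV, hV⟩ := exists_affine_le hx
  refine ⟨V.1, hV, hxV, ?_⟩
  rw [← appL_res]
  exact h V ⟨_, rfl⟩

lemma le_iff_sections {N N' : Subobject M} :
    N ≤ N' ↔ ∀ U : X.affineOpens, sections N U.1 ≤ sections N' U.1 := by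
  constructor
  · intro h U
    have := (factors_iff_range_le N.arrow N').1 ((Subobject.factors_iff _ _).2
      ⟨Subobject.ofLE _ _ h, Subobject.ofLE_arrow h⟩)
    exact this U.1
  · intro h
    exact Subobject.le_of_comm (N'.factorThru N.arrow ((factors_iff_range_le _ _).2
      (range_le_sections_of_affine N.arrow N' h))) (Subobject.factorThru_arrow _ _ _)

lemma ext_sections {N N' : Subobject M}
    (h : ∀ U : X.affineOpens, sections N U.1 = sections N' U.1) : N = N' :=
  le_antisymm (le_iff_sections.2 fun U ↦ (h U).le) (le_iff_sections.2 fun U ↦ (h U).ge)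

lemma sections_mono {N N' : Subobject M} (h : N ≤ N') (U : X.affineOpens) :
    sections N U.1 ≤ sections N' U.1 :=
  le_iff_sections.1 h U

lemma sections_top (U : X.Opens) : sections (⊤ : Subobject M) U = ⊤ := by
  rw [sections_eq_range, LinearMap.range_eq_top]
  intro s
  refine ⟨appL (inv (⊤ : Subobject M).arrow) U s, ?_⟩
  rw [← appL_comp, IsIso.inv_hom_id]
  rfl

instance (hM : Localizes M) {P : ∀ U : X.affineOpens, Submodule Γ(X, U) Γ(M, U)}
    (hP : IsQCFamily P) : Mono (hP.incl hM) :=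
  mono_of_appL_injective _ fun _ _ _ h ↦ Subtype.ext h

/-- The subobject defined by a family. -/
def IsQCFamily.toSubobject (hM : Localizes M)
    {P : ∀ U : X.affineOpens, Submodule Γ(X, U) Γ(M, U)} (hP : IsQCFamily P) : Subobject M :=
  Subobject.mk (hP.incl hM)

lemma IsQCFamily.sections_toSubobject (hM : Localizes M)
    {P : ∀ U : X.affineOpens, Submodule Γ(X, U) Γ(M, U)} (hP : IsQCFamily P)
    (U : X.affineOpens) : sections (hP.toSubobject hM) U.1 = P U := by
  rw [IsQCFamily.toSubobject, sections_mk, hP.range_incl]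
  ext s
  exact hP.mem_carrier_affine hM U s

lemma isQCFamily_range {K : X.Modules} (hK : Localizes K) (φ : K ⟶ M) :
    IsQCFamily fun U : X.affineOpens ↦ LinearMap.range (appL φ U.1) where
  res_mem U f t ht := by
    obtain ⟨s, rfl⟩ := ht
    exact ⟨res K (X.basicOpen_le f) s, appL_res φ _ s⟩
  exists_pow U f s hs := by
    obtain ⟨s', rfl⟩ := hs
    obtain ⟨n, t, ht⟩ := hK.exists_pow U f s'
    refine ⟨n, appL φ U.1 t, ⟨t, rfl⟩, ?_⟩
    rw [← appL_res, ht]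
    exact (appL φ (X.basicOpen f)).map_smul _ _

lemma localizes_toSubobject (hM : Localizes M)
    {P : ∀ U : X.affineOpens, Submodule Γ(X, U) Γ(M, U)} (hP : IsQCFamily P) :
    Localizes (hP.toSubobject hM : X.Modules) := by
  set N := hP.toSubobject hM
  have hN := hP.sections_toSubobject hM
  constructor
  · intro U f s
    have hs : appL N.arrow _ s ∈ P (X.affineBasicOpen f) := by
      rw [← hN]
      exact ⟨s, rfl⟩
    obtain ⟨n, t, ht, e⟩ := hP.exists_pow U f _ hs
    rw [← hN] at ht
    obtain ⟨t, rfl⟩ := ht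
    refine ⟨n, t, appL_injective N.arrow _ ?_⟩
    rw [appL_res, map_smul]
    exact e
  · intro U f t ht
    obtain ⟨n, hn⟩ := hM.exists_pow_zero U f (appL N.arrow _ t) (by rw [← appL_res, ht, map_zero])
    refine ⟨n, appL_injective N.arrow _ ?_⟩
    rw [map_smul, hn, map_zero]

/-- Quasi-coherent images are computed on sections over affine opens. -/
lemma sections_imageSubobject {K : X.Modules} (hM : Localizes M) (hK : Localizes K) (φ : K ⟶ M)
    (U : X.affineOpens) :
    sections (imageSubobject φ) U.1 = LinearMap.range (appL φ U.1) := by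
  have hP := isQCFamily_range hK φ
  refine le_antisymm ?_ ?_
  -- The image is the least subobject through which `φ` factors, and the family of ranges already
  -- defines such a subobject.
  · rw [← hP.sections_toSubobject hM U]
    refine sections_mono ?_ U
    have hf : (hP.toSubobject hM).Factors φ := (factors_iff_range_le _ _).2
      (range_le_sections_of_affine _ _ fun V ↦ (hP.sections_toSubobject hM V).ge)
    exact imageSubobject_le φ ((hP.toSubobject hM).factorThru φ hf)
      (Subobject.factorThru_arrow _ _ _)
  · refine (factors_iff_range_le _ _).1 ?_ U.1
    exact (Subobject.factors_iff _ _).2 ⟨factorThruImageSubobject φ, imageSubobject_arrow_comp φ⟩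

end Subobjects

/-! ### Coherence in terms of sections over affine opens -/

section Coherence

open TopologicalSpace

variable {X : Scheme.{u}}

/-- From modules on `Spec Γ(X, U)` to modules on the slice site over `U`. -/
def specToOver {U : X.Opens} (hU : IsAffineOpen U) :
    SheafOfModules.{u} (Spec Γ(X, U)).ringCatSheaf ⥤ SheafOfModules.{u} (X.ringCatSheaf.over U) :=
  Scheme.Modules.restrictFunctor hU.isoSpec.hom ⋙ (Scheme.Modules.overEquiv U).inverse

instance {U : X.Opens} (hU : IsAffineOpen U) :
    PreservesColimitsOfSize.{u, u} (specToOver hU) :=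
  inferInstanceAs (PreservesColimitsOfSize.{u, u}
    (Scheme.Modules.restrictFunctor hU.isoSpec.hom ⋙ (Scheme.Modules.overEquiv U).inverse))

/-- `specToOver` preserves the structure sheaf. -/
def specToOverUnit {U : X.Opens} (hU : IsAffineOpen U) :
    SheafOfModules.unit (X.ringCatSheaf.over U) ≅
      (specToOver hU).obj (SheafOfModules.unit (Spec Γ(X, U)).ringCatSheaf) :=
  (Scheme.Modules.overEquiv U).unitIso.app _ ≪≫
    (Scheme.Modules.overEquiv U).inverse.mapIso (Scheme.Modules.restrictUnitIso hU.isoSpec.hom).symm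

/-- `specToOver` takes the restriction of a module to its restriction. -/
def specToOverRestrict {U : X.Opens} (hU : IsAffineOpen U) (K : X.Modules) :
    (specToOver hU).obj (K.restrict hU.fromSpec) ≅ SheafOfModules.over K U :=
  (Scheme.Modules.overEquiv U).inverse.mapIso
    ((Scheme.Modules.restrictFunctorComp hU.isoSpec.hom hU.fromSpec).symm.app K ≪≫
      (Scheme.Modules.restrictFunctorCongr hU.isoSpec_hom_fromSpec).app K ≪≫
      (Scheme.Modules.overFunctorEquiv U).symm.app K) ≪≫
    ((Scheme.Modules.overEquiv U).unitIso.app _).symm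

/-- A presentation on `Spec Γ(X, U)` gives one on the slice site over `U`. -/
def presentationOver {U : X.Opens} (hU : IsAffineOpen U) (K : X.Modules)
    (p : (K.restrict hU.fromSpec).Presentation) :
    (SheafOfModules.over K U).Presentation :=
  SheafOfModules.Presentation.ofIsIso (specToOverRestrict hU K).hom
    (p.map (specToOver hU) (specToOverUnit hU))

lemma coversTop_of_forall_mem {ι : Type u} (U : ι → X.Opens) (h : ∀ x, ∃ i, x ∈ U i) :
    (Opens.grothendieckTopology X).CoversTop U := by
  rw [Opens.coversTop_iff, IsOpenCover]
  exact top_le_iff.1 fun x _ ↦ Opens.mem_iSup.2 (h x)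

lemma isQuasicoherent_of_presentations (K : X.Modules)
    (h : ∀ x : X, ∃ (U : X.Opens) (hU : IsAffineOpen U), x ∈ U ∧
      Nonempty (K.restrict hU.fromSpec).Presentation) : K.IsQuasicoherent := by
  choose U hU hx p using h
  exact SheafOfModules.QuasicoherentData.isQuasicoherent (M := K)
    { I := X
      X := U
      coversTop := coversTop_of_forall_mem U fun x ↦ ⟨x, hx x⟩
      presentation x := presentationOver (hU x) K (p x).some }

lemma isFiniteType_of_presentations (K : X.Modules)
    (h : ∀ x : X, ∃ (U : X.Opens) (hU : IsAffineOpen U), x ∈ U ∧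
      ∃ p : (K.restrict hU.fromSpec).Presentation, Finite p.generators.I) :
    K.IsFiniteType := by
  choose U hU hx p hp using h
  let σ : SheafOfModules.LocalGeneratorsData.{u} (R := X.ringCatSheaf) K :=
    { I := X
      X := U
      coversTop := coversTop_of_forall_mem U fun x ↦ ⟨x, hx x⟩
      generators x := (presentationOver (hU x) K (p x)).generators }
  have hσ : σ.IsFiniteType := by
    constructor
    intro i
    constructor
    exact hp i
  exact SheafOfModules.IsFiniteType.mk (R := X.ringCatSheaf) (M := K) ⟨σ, hσ⟩

lemma res_bijective_of_eq (K : X.Modules) {U V : X.Opens} (h : V ≤ U) (e : V = U) :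
    Function.Bijective (res K h) := by
  subst e
  exact ⟨fun s t hst ↦ by simpa using hst, fun s ↦ ⟨s, by simp⟩⟩

/-- The sections over an affine open set are the global sections of the restriction to `Spec`. -/
def sectionsEquivSpec (K : X.Modules) {U : X.Opens} (hU : IsAffineOpen U) :
    Γ(K, U) ≃ₗ[Γ(X, U)]
      (modulesSpecToSheaf.obj (K.restrict hU.fromSpec)).presheaf.obj (Opposite.op ⊤) :=
  LinearEquiv.ofBijective
    ({ toFun s := res K (fromSpec_image_le hU ⊤) s
       map_add' s t := map_add (res K (fromSpec_image_le hU ⊤)) s t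
       map_smul' r s := (res_smul _ r s).trans (restrict_fromSpec_smul K hU ⊤ r _).symm } :
      Γ(K, U) →ₗ[Γ(X, U)]
        (modulesSpecToSheaf.obj (K.restrict hU.fromSpec)).presheaf.obj (Opposite.op ⊤))
    (res_bijective_of_eq K (fromSpec_image_le hU ⊤) (fromSpec_image_top hU))

/-- If the sections of `K` over affine open sets localize, then the restriction of `K` to
`U` has a presentation with finitely many generators if these sections are finitely generated. -/
lemma exists_presentation {K : X.Modules} (hK : Localizes K) {U : X.Opens} (hU : IsAffineOpen U)
    (hfin : Module.Finite Γ(X, U) Γ(K, U)) :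
    ∃ p : (K.restrict hU.fromSpec).Presentation, Finite p.generators.I := by
  have h := (localizes_iff_isLocalizing K).1 hK U hU
  rw [← isIso_fromTildeΓ_iff_isLocalizing] at h
  have hL := Module.Finite.equiv (sectionsEquivSpec K hU)
  set K' := K.restrict hU.fromSpec
  set L := (modulesSpecToSheaf.obj K').presheaf.obj (Opposite.op ⊤)
  obtain ⟨s, hs⟩ := hL
  have h' : @IsIso (SheafOfModules (Spec Γ(X, U)).ringCatSheaf) _ _ _ K'.fromTildeΓ := h
  -- The generators are the finite set `s`; the whole kernel serves as the set of relations.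
  exact ⟨SheafOfModules.Presentation.ofIsIso K'.fromTildeΓ
    (presentationTilde L (s : Set L) hs _ (Submodule.span_eq _)), inferInstanceAs (Finite s)⟩

/-- The inverse of `specToOver`, with restriction to a smaller affine open set. -/
def overToSpec {U V : X.Opens} (hU : IsAffineOpen U) (h : U ≤ V) :
    SheafOfModules.{u} (X.ringCatSheaf.over V) ⥤ SheafOfModules.{u} (Spec Γ(X, U)).ringCatSheaf :=
  (Scheme.Modules.overEquiv V).functor ⋙
    Scheme.Modules.restrictFunctor (hU.isoSpec.inv ≫ X.homOfLE h)

instance {U V : X.Opens} (hU : IsAffineOpen U) (h : U ≤ V) :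
    PreservesColimitsOfSize.{u, u} (overToSpec hU h) :=
  inferInstanceAs (PreservesColimitsOfSize.{u, u} ((Scheme.Modules.overEquiv V).functor ⋙
    Scheme.Modules.restrictFunctor (hU.isoSpec.inv ≫ X.homOfLE h)))

/-- `overToSpec` is restriction. -/
def overToSpecRestrict {U V : X.Opens} (hU : IsAffineOpen U) (h : U ≤ V) (K : X.Modules) :
    (overToSpec hU h).obj (SheafOfModules.over K V) ≅ K.restrict hU.fromSpec :=
  (Scheme.Modules.restrictFunctor (hU.isoSpec.inv ≫ X.homOfLE h)).mapIso
      ((Scheme.Modules.overFunctorEquiv V).app K) ≪≫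
    (Scheme.Modules.restrictFunctorComp _ _).symm.app K ≪≫
    (Scheme.Modules.restrictFunctorCongr (by simp [IsAffineOpen.isoSpec_inv_ι])).app K

/-- Finitely many generating sections give an epimorphism between sheaves associated to modules. The
functor `tilde` is fully faithful, so it comes from a surjection from a finite free module. -/
lemma finite_of_generatingSections {R : CommRingCat.{u}} (K : (Spec R).Modules)
    (hK : IsIso K.fromTildeΓ) (σ : K.GeneratingSections) (hσ : Finite σ.I) :
    Module.Finite R ((modulesSpecToSheaf.obj K).presheaf.obj (Opposite.op ⊤)) := by
  set L := (modulesSpecToSheaf.obj K).presheaf.obj (Opposite.op ⊤)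
  let E : (Spec R).Modules := SheafOfModules.free σ.I
  let π : E ⟶ K := σ.π
  have hπ : Epi π := σ.epi
  let τ : (tilde.functor R).obj (ModuleCat.of R (σ.I →₀ R)) ≅ E := tildeFinsupp σ.I
  let ρ : K ⟶ (tilde.functor R).obj L := @inv _ _ _ _ K.fromTildeΓ hK
  have hρ : IsIso ρ := @IsIso.inv_isIso _ _ _ _ K.fromTildeΓ hK
  let g : (tilde.functor R).obj (ModuleCat.of R (σ.I →₀ R)) ⟶ (tilde.functor R).obj L :=
    τ.hom ≫ π ≫ ρ
  have hg : Epi g := epi_comp _ _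
  have : Epi ((tilde.functor R).preimage g) := by
    refine (tilde.functor R).epi_of_epi_map ?_
    rwa [Functor.map_preimage]
  have hs := (ModuleCat.epi_iff_surjective _).1 this
  exact Module.Finite.of_surjective ((tilde.functor R).preimage g).hom hs

lemma finite_of_generatingSections_over {K : X.Modules} (hK : K.IsQuasicoherent) {V W : X.Opens}
    (hV : IsAffineOpen V) (h : V ≤ W)
    (σ : (SheafOfModules.over (R := X.ringCatSheaf) K W).GeneratingSections)
    (hσ : Finite σ.I) : Module.Finite Γ(X, V) Γ(K, V) := by
  have hi := (localizes_iff_isLocalizing K).1 (localizes_of_isQuasicoherent K hK) V hV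
  rw [← isIso_fromTildeΓ_iff_isLocalizing] at hi
  let e := overToSpecRestrict hV h K
  have he : Epi e.hom := @IsIso.epi_of_iso _ _ _ _ e.hom e.isIso_hom
  let G := (σ.map (overToSpec hV h) (Scheme.Modules.restrictUnitIso _).symm).ofEpi e.hom
  have hf : Finite G.I := hσ
  have := finite_of_generatingSections _ hi G hf
  exact Module.Finite.equiv (sectionsEquivSpec K hV).symm

/-- Finite local generators at every point. -/
lemma exists_affine_finite {K : X.Modules} (hK : IsCoherent K) (x : X) :
    ∃ U : X.affineOpens, x ∈ U.1 ∧
      ∀ V : X.affineOpens, V.1 ≤ U.1 → Module.Finite Γ(X, V) Γ(K, V) := by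
  obtain ⟨σ, hσ⟩ := hK.2.exists_localGeneratorsData
  have hc := σ.coversTop
  rw [Opens.coversTop_iff, IsOpenCover] at hc
  have hx : x ∈ ⨆ i, σ.X i := by rw [hc]; trivial
  obtain ⟨i, hi⟩ := Opens.mem_iSup.1 hx
  obtain ⟨U, hxU, hU⟩ := exists_affine_le hi
  refine ⟨U, hxU, ?_⟩
  intro V hV
  exact finite_of_generatingSections_over hK.1 V.2 (hV.trans hU) (σ.generators i)
    (hσ.isFiniteType i).finite

lemma exists_pow_resO (U : X.affineOpens) (f : Γ(X, U)) (r : Γ(X, X.basicOpen f)) :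
    ∃ (n : ℕ) (a : Γ(X, U)), resO (X.basicOpen_le f) a = resO (X.basicOpen_le f) f ^ n * r := by
  have := U.2.isLocalization_basicOpen f
  obtain ⟨⟨a, ⟨_, n, rfl⟩⟩, h⟩ := IsLocalization.surj (Submonoid.powers f) r
  refine ⟨n, a, ?_⟩
  rw [mul_comm, ← map_pow]
  exact h.symm

/-- The sections over `D(f)` that are fractions with numerators in a given submodule. -/
def fractions {K : X.Modules} (U : X.affineOpens) (f : Γ(X, U)) (Q : Submodule Γ(X, U) Γ(K, U)) :
    Submodule Γ(X, X.basicOpen f) Γ(K, X.basicOpen f) where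
  carrier := {s | ∃ t ∈ Q, ∃ n : ℕ,
    res K (X.basicOpen_le f) t = resO (X.basicOpen_le f) f ^ n • s}
  add_mem' := by
    rintro s s' ⟨t, ht, n, e⟩ ⟨t', ht', n', e'⟩
    refine ⟨f ^ n' • t + f ^ n • t', add_mem (Q.smul_mem _ ht) (Q.smul_mem _ ht'), n' + n, ?_⟩
    rw [map_add, res_smul, res_smul, e, e', map_pow, map_pow, smul_add, smul_smul, smul_smul,
      pow_add, mul_comm (_ ^ n)]
  zero_mem' := ⟨0, zero_mem _, 0, by simp⟩
  smul_mem' := by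
    rintro r s ⟨t, ht, n, e⟩
    obtain ⟨m, a, ha⟩ := exists_pow_resO U f r
    refine ⟨a • t, Q.smul_mem _ ht, m + n, ?_⟩
    rw [res_smul, e, ha, smul_smul, smul_smul, pow_add]
    congr 1
    ring

/-- Finiteness is known only near each point. By quasi-compactness finitely many `D(f)` suffice.
Clearing denominators lifts the local generators to `U`, and the union of the lifts generates by
`mem_of_locally_basicOpen`. -/
lemma finite_sections {K : X.Modules} (hK : IsCoherent K) (U : X.affineOpens) :
    Module.Finite Γ(X, U) Γ(K, U) := by
  have hloc := localizes_of_isQuasicoherent K hK.1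
  have H : ∀ x : U.1, ∃ (f : Γ(X, U)), x.1 ∈ X.basicOpen f ∧ ∃ T : Finset Γ(K, U),
      ∀ s : Γ(K, U), ∃ t ∈ Submodule.span Γ(X, U) (T : Set Γ(K, U)), ∃ n : ℕ,
        res K (X.basicOpen_le f) t =
          resO (X.basicOpen_le f) f ^ n • res K (X.basicOpen_le f) s := by
    rintro ⟨x, hx⟩
    obtain ⟨W, hxW, hW⟩ := exists_affine_finite hK x
    obtain ⟨f, g, e, hxf⟩ := exists_basicOpen_le_affine_inter U.2 W.2 x ⟨hx, hxW⟩
    obtain ⟨G, hG⟩ : (⊤ : Submodule Γ(X, X.basicOpen f) Γ(K, X.basicOpen f)).FG := (hW (X.affineBasicOpen f) (e.le.trans (X.basicOpen_le g))).fg_top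
    choose n t ht using fun s ↦ hloc.exists_pow U f s
    classical
    refine ⟨f, hxf, G.image t, fun s ↦ ?_⟩
    have hle : Submodule.span Γ(X, X.basicOpen f) (G : Set Γ(K, X.basicOpen f)) ≤
        fractions U f (Submodule.span Γ(X, U) (G.image t : Set Γ(K, U))) := by
      refine Submodule.span_le.2 fun a ha ↦ ?_
      exact ⟨t a, Submodule.subset_span (Finset.mem_coe.2 (Finset.mem_image_of_mem t ha)), n a,
        ht a⟩
    exact hle (hG.ge Submodule.mem_top)
  choose f hf T hT using H
  obtain ⟨A, hA⟩ := U.2.isCompact.elim_finite_subcover (fun x ↦ (X.basicOpen (f x) : Set X))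
    (fun x ↦ (X.basicOpen (f x)).isOpen) (fun x hx ↦ Set.mem_iUnion.2 ⟨⟨x, hx⟩, hf ⟨x, hx⟩⟩)
  classical
  refine ⟨⟨A.biUnion T, eq_top_iff.2 fun s _ ↦ ?_⟩⟩
  refine mem_of_locally_basicOpen hloc _ s fun x hx ↦ ?_
  obtain ⟨y, hy, hxy⟩ := Set.mem_iUnion₂.1 (hA hx)
  obtain ⟨t, ht, n, e⟩ := hT y s
  exact ⟨f y, hxy, t, Submodule.span_mono (fun a ha ↦ Finset.mem_biUnion.2 ⟨y, hy, ha⟩) ht, n, e⟩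

/-- Converse to `localizes_of_isQuasicoherent` and `finite_sections`: coherence can be verified
entirely on sections over affine opens. -/
lemma isCoherent_of_localizes {K : X.Modules} (hK : Localizes K)
    (hfin : ∀ U : X.affineOpens, Module.Finite Γ(X, U) Γ(K, U)) : IsCoherent K := by
  have H : ∀ x : X, ∃ (U : X.Opens) (hU : IsAffineOpen U), x ∈ U ∧
      ∃ p : (K.restrict hU.fromSpec).Presentation, Finite p.generators.I := by
    intro x
    obtain ⟨U, hx, -⟩ := exists_affine_le (X := X) (x := x) (U := ⊤) trivial
    exact ⟨U.1, U.2, hx, exists_presentation hK U.2 (hfin U)⟩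
  refine ⟨isQuasicoherent_of_presentations K fun x ↦ ?_, isFiniteType_of_presentations K H⟩
  obtain ⟨U, hU, hx, p, -⟩ := H x
  exact ⟨U, hU, hx, ⟨p⟩⟩

end Coherence

/-! ### Pullbacks of quasi-coherent modules -/

section Pullback

open TopologicalSpace

variable {W X : Scheme.{u}}

lemma exists_affine_le_preimage (f : W ⟶ X) (w : W) (T : W.Opens) (hw : w ∈ T) :
    ∃ (U : X.affineOpens) (V : W.affineOpens), w ∈ V.1 ∧ V.1 ≤ f ⁻¹ᵁ U.1 ∧ V.1 ≤ T := by
  obtain ⟨U, hU, -⟩ := exists_affine_le (X := X) (x := f w) (U := ⊤) trivial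
  obtain ⟨V, hV, hVU⟩ := exists_affine_le (X := W) (x := w) (U := f ⁻¹ᵁ U.1 ⊓ T) ⟨hU, hw⟩
  exact ⟨U, V, hV, hVU.trans inf_le_left, hVU.trans inf_le_right⟩

/-- The open set `⊤` is terminal in each comma category. Finality is what makes the pullback of the
structure sheaf the structure sheaf. -/
instance (f : W ⟶ X) : (Opens.map f.base).Final where
  out V := by
    let T : StructuredArrow V (Opens.map f.base) :=
      StructuredArrow.mk (Y := (⊤ : X.Opens)) (homOfLE le_top)
    have hT : IsTerminal T := IsTerminal.ofUniqueHom
      (fun Y ↦ StructuredArrow.homMk (homOfLE le_top) (Subsingleton.elim _ _))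
      (fun Y m ↦ by ext; exact Subsingleton.elim _ _)
    exact isConnected_of_isTerminal _ hT

lemma nonempty_presentation_restrict {K : X.Modules} (hK : K.IsQuasicoherent) {U : X.Opens}
    (hU : IsAffineOpen U) : Nonempty (K.restrict hU.fromSpec).Presentation := by
  have h := (localizes_iff_isLocalizing K).1 (localizes_of_isQuasicoherent K hK) U hU
  rw [← isIso_fromTildeΓ_iff_isLocalizing] at h
  set K' := K.restrict hU.fromSpec
  set L := (modulesSpecToSheaf.obj K').presheaf.obj (Opposite.op ⊤)
  have h' : @IsIso (SheafOfModules (Spec Γ(X, U)).ringCatSheaf) _ _ _ K'.fromTildeΓ := h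
  exact ⟨SheafOfModules.Presentation.ofIsIso K'.fromTildeΓ
    (presentationTilde L Set.univ (by simp) _ (Submodule.span_eq _))⟩

/-- The pullback functor with its type unfolded. -/
def pullbackSheaf (g : W ⟶ X) :
    SheafOfModules.{u} X.ringCatSheaf ⥤ SheafOfModules.{u} W.ringCatSheaf :=
  Scheme.Modules.pullback g

instance (g : W ⟶ X) : PreservesColimitsOfSize.{u, u} (pullbackSheaf g) :=
  inferInstanceAs (PreservesColimitsOfSize.{u, u} (Scheme.Modules.pullback g))

/-- The pullback of the structure sheaf. -/
def pullbackSheafUnit (g : W ⟶ X) : SheafOfModules.unit W.ringCatSheaf ≅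
    (pullbackSheaf g).obj (SheafOfModules.unit X.ringCatSheaf) :=
  haveI : (SheafOfModules.pushforward.{u} g.toRingCatSheafHom).IsRightAdjoint :=
    inferInstanceAs (Scheme.Modules.pushforward g).IsRightAdjoint
  haveI := SheafOfModules.instIsIsoPullbackObjUnitToUnitOfFinal (F := Opens.map g.base)
    g.toRingCatSheafHom
  (asIso (SheafOfModules.pullbackObjUnitToUnit g.toRingCatSheafHom)).symm

/-- The restriction of a pullback to an affine open set. -/
def restrictPullbackIso (f : W ⟶ X) (M : X.Modules) {U : X.Opens} (hU : IsAffineOpen U)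
    {V : W.Opens} (hV : IsAffineOpen V) (h : V ≤ f ⁻¹ᵁ U) :
    ((Scheme.Modules.pullback f).obj M).restrict hV.fromSpec ≅
      (Scheme.Modules.pullback (Spec.map (f.appLE U V h))).obj (M.restrict hU.fromSpec) :=
  (Scheme.Modules.restrictFunctorIsoPullback hV.fromSpec).app _ ≪≫
    (Scheme.Modules.pullbackComp hV.fromSpec f).app M ≪≫
    (Scheme.Modules.pullbackCongr (IsAffineOpen.SpecMap_appLE_fromSpec f hU hV h).symm).app M ≪≫
    ((Scheme.Modules.pullbackComp (Spec.map (f.appLE U V h)) hU.fromSpec).app M).symm ≪≫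
    (Scheme.Modules.pullback _).mapIso
      ((Scheme.Modules.restrictFunctorIsoPullback hU.fromSpec).app M).symm

/-- Pullback preserves colimits and the structure sheaf, so it carries local presentations to local
presentations. -/
lemma isQuasicoherent_pullback (f : W ⟶ X) {M : X.Modules} (hM : M.IsQuasicoherent) :
    ((Scheme.Modules.pullback f).obj M).IsQuasicoherent := by
  refine isQuasicoherent_of_presentations _ fun w ↦ ?_
  obtain ⟨⟨U, hU⟩, ⟨V, hV⟩, hwV, h, -⟩ := exists_affine_le_preimage f w ⊤ trivial
  change V ≤ f ⁻¹ᵁ U at h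
  replace hU : IsAffineOpen U := hU
  obtain ⟨p⟩ := nonempty_presentation_restrict hM hU
  replace hV : IsAffineOpen V := hV
  refine ⟨V, hV, hwV, ?_⟩
  let e' : (pullbackSheaf (Spec.map (f.appLE U V h))).obj (M.restrict hU.fromSpec) ≅
    (((Scheme.Modules.pullback f).obj M).restrict hV.fromSpec) :=
      (restrictPullbackIso f M hU hV h).symm
  have he : IsIso e'.hom := e'.isIso_hom
  exact ⟨SheafOfModules.Presentation.ofIsIso e'.hom
    (p.map (pullbackSheaf (Spec.map (f.appLE U V h))) (pullbackSheafUnit _))⟩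

end Pullback

/-! ### Base change for sections of pullbacks -/

section BaseChange

open TopologicalSpace

variable {W X Z : Scheme.{u}}

/-- A morphism from a quasi-coherent module to a pushforward is determined on an affine open set
that contains the image. -/
lemma hom_pushforward_ext {K : X.Modules} (hK : Localizes K) (U : X.affineOpens) (k : Z ⟶ X)
    (hk : ∀ z, k z ∈ U.1) (E : Z.Modules)
    (Ψ₁ Ψ₂ : K ⟶ (Scheme.Modules.pushforward k).obj E)
    (h : ∀ s : Γ(K, U), appL Ψ₁ U.1 s = appL Ψ₂ U.1 s) : Ψ₁ = Ψ₂ := by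
  refine hom_ext_appL fun T s ↦ ?_
  refine section_ext (M := E) (U := k ⁻¹ᵁ T) fun z hz ↦ ?_
  obtain ⟨f, hfT, hf⟩ := U.2.exists_basicOpen_le ⟨k z, hz⟩ (hk z)
  refine ⟨k ⁻¹ᵁ X.basicOpen f, fun _ hx ↦ hfT hx, hf, ?_⟩
  change res ((Scheme.Modules.pushforward k).obj E) hfT (appL Ψ₁ T s) =
    res ((Scheme.Modules.pushforward k).obj E) hfT (appL Ψ₂ T s)
  rw [← appL_res, ← appL_res]
  obtain ⟨n, t, ht⟩ := hK.exists_pow U f (res K hfT s)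
  -- A power of `f` makes the section extend to `U`, where the two morphisms agree; over `D(f)` that
  -- power can be cancelled.
  refine smul_pow_injective (M := (Scheme.Modules.pushforward k).obj E) (X.basicOpen_le f) f
    le_rfl n ?_
  have e₁ := (appL Ψ₁ (X.basicOpen f)).map_smul (resO (X.basicOpen_le f) f ^ n) (res K hfT s)
  have e₂ := (appL Ψ₂ (X.basicOpen f)).map_smul (resO (X.basicOpen_le f) f ^ n) (res K hfT s)
  rw [← e₁, ← e₂, ← ht, appL_res, appL_res, h]

/-- A linear map of global sections comes from a morphism if the source is quasi-coherent. -/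
lemma exists_hom_of_sections {R : CommRingCat.{u}} {M N : (Spec R).Modules}
    (hM : IsIso M.fromTildeΓ)
    (ψ : (modulesSpecToSheaf.obj M).presheaf.obj (Opposite.op ⊤) ⟶
      (modulesSpecToSheaf.obj N).presheaf.obj (Opposite.op ⊤)) :
    ∃ θ : M ⟶ N, ∀ s : (modulesSpecToSheaf.obj M).presheaf.obj (Opposite.op ⊤),
      appL θ ⊤ s = ψ.hom s := by
  refine ⟨inv M.fromTildeΓ ≫ tilde.map ψ ≫ N.fromTildeΓ, fun s ↦ ?_⟩
  have h₁ := congr($(M.toOpen_fromTildeΓ_app ⊤).hom s)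
  have h₂ := fun s ↦ congr($(tilde.toOpen_map_app ψ ⊤).hom s)
  have h₃ := fun s ↦ congr($(N.toOpen_fromTildeΓ_app ⊤).hom s)
  have h₁' : appL M.fromTildeΓ ⊤ ((tilde.toOpen _ ⊤).hom s) = s := by
    refine h₁.trans ?_
    exact res_self (M := M) s
  have h₃' : ∀ s, appL N.fromTildeΓ ⊤ ((tilde.toOpen _ ⊤).hom s) = s := fun s ↦
    (h₃ s).trans (res_self (M := N) s)
  have e : appL (inv M.fromTildeΓ) ⊤ s = (tilde.toOpen _ ⊤).hom s := by
    refine appL_injective M.fromTildeΓ ⊤ (Eq.trans ?_ h₁'.symm)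
    exact DFunLike.congr_fun (congrArg (fun φ ↦ appL φ ⊤) (IsIso.inv_hom_id M.fromTildeΓ)) s
  refine (congrArg (fun t ↦ appL N.fromTildeΓ ⊤ (appL (tilde.map ψ) ⊤ t)) e).trans ?_
  exact (congrArg (appL N.fromTildeΓ ⊤) (h₂ s)).trans (h₃' _)

/-- Semilinear maps on the sections over an affine open set extend to morphisms to a
pushforward. -/
lemma exists_hom_pushforward {K : X.Modules} (hK : Localizes K) {U : X.Opens}
    (hU : IsAffineOpen U) (g : Z ⟶ Spec Γ(X, U)) (k : Z ⟶ X)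
    (hk : k = g ≫ hU.fromSpec) (E : Z.Modules) (ψ : Γ(K, U) →+ Γ(E, ⊤))
    (hψ : ∀ (r : Γ(X, U)) s, ψ (r • s) = (g.appTop ((Scheme.ΓSpecIso _).inv r) :) • ψ s) :
    ∃ Ψ : K ⟶ (Scheme.Modules.pushforward k).obj E, ∀ (h : ⊤ ≤ k ⁻¹ᵁ U) s, res E h (appL Ψ U s) = ψ s := by
  subst hk
  have hi := (localizes_iff_isLocalizing K).1 hK U hU
  rw [← isIso_fromTildeΓ_iff_isLocalizing] at hi
  set K' := K.restrict hU.fromSpec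
  let F : (Spec Γ(X, U)).Modules := (Scheme.Modules.pushforward g).obj E
  let ψ' : (modulesSpecToSheaf.obj K').presheaf.obj (Opposite.op ⊤) →ₗ[Γ(X, U)]
      (modulesSpecToSheaf.obj F).presheaf.obj (Opposite.op ⊤) :=
      { toFun s := ψ ((sectionsEquivSpec K hU).symm s)
        map_add' s t := by
          exact (congrArg ψ (map_add (sectionsEquivSpec K hU).symm s t)).trans (map_add ψ _ _)
        map_smul' r s := by
          exact (congrArg ψ (map_smul (sectionsEquivSpec K hU).symm r s)).trans (hψ r _) }
  obtain ⟨θ, hθ'⟩ := exists_hom_of_sections hi (ConcreteCategory.ofHom ψ')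
  have hθ : ∀ s : Γ(K, U), appL θ ⊤ ((sectionsEquivSpec K hU) s) = ψ s := fun s ↦
    (hθ' _).trans (congrArg ψ ((sectionsEquivSpec K hU).symm_apply_apply s))
  -- `θ` maps the restriction of `K` to `Spec` into `g_* E`; its transpose under the adjunction of
  -- restriction and pushforward lands in `k_* E`.
  refine ⟨(Scheme.Modules.restrictAdjunction hU.fromSpec).homEquiv _ _ θ ≫
    ((Scheme.Modules.pushforwardComp g hU.fromSpec).hom.app E), fun h s ↦ ?_⟩
  rw [← hθ, Adjunction.homEquiv_unit]
  change res E h (appL θ (hU.fromSpec ⁻¹ᵁ U) (res K (hU.fromSpec.image_preimage_le U) s)) = _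
  have h' : ⊤ ≤ hU.fromSpec ⁻¹ᵁ U := hU.fromSpec_preimage_self.ge
  refine (appL_res θ h' _).symm.trans (congrArg (appL θ ⊤) ?_)
  exact res_res (M := K) _ _ s

/-- The pullback of sections. -/
def pullSec (f : W ⟶ X) (M : X.Modules) {U : X.Opens} {V : W.Opens} (h : V ≤ f ⁻¹ᵁ U) :
    Γ(M, U) →ₛₗ[(f.appLE U V h).hom] Γ((Scheme.Modules.pullback f).obj M, V) where
  toFun s := res ((Scheme.Modules.pullback f).obj M) h
    (appL ((Scheme.Modules.pullbackPushforwardAdjunction f).unit.app M) U s)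
  map_add' s t := by
    rw [map_add]
    exact map_add (res ((Scheme.Modules.pullback f).obj M) h) _ _
  map_smul' r s := by
    rw [map_smul]
    exact res_smul (M := (Scheme.Modules.pullback f).obj M) h _ _

lemma appL_pullSec (f : W ⟶ X) {M N : X.Modules} (φ : M ⟶ N) {U : X.Opens} {V : W.Opens}
    (h : V ≤ f ⁻¹ᵁ U) (s : Γ(M, U)) :
    appL ((Scheme.Modules.pullback f).map φ) V (pullSec f M h s) =
      pullSec f N h (appL φ U s) := by
  refine (appL_res ((Scheme.Modules.pullback f).map φ) h _).trans ?_
  refine congrArg (res ((Scheme.Modules.pullback f).obj N) h) ?_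
  have := (Scheme.Modules.pullbackPushforwardAdjunction f).unit.naturality φ
  exact DFunLike.congr_fun (congrArg (fun φ ↦ appL φ U) this.symm) s

lemma appL_pullSec_adj (f : W ⟶ X) {M : X.Modules} {E : W.Modules}
    (Ξ : (Scheme.Modules.pullback f).obj M ⟶ E) {U : X.Opens} {V : W.Opens}
    (h : V ≤ f ⁻¹ᵁ U) (s : Γ(M, U)) :
    appL Ξ V (pullSec f M h s) = res E h
      (appL ((Scheme.Modules.pullbackPushforwardAdjunction f).homEquiv _ _ Ξ) U s) := by
  rw [Adjunction.homEquiv_unit]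
  exact appL_res Ξ h _

end BaseChange

/-- The universal property of the extension of scalars, for semilinear maps. -/
def IsExtension {A B : Type u} [CommRing A] [CommRing B] (ρ : A →+* B) {M N : Type u}
    [AddCommGroup M] [AddCommGroup N] [Module A M] [Module B N] (p : M →ₛₗ[ρ] N) : Prop :=
  ∀ (Q : Type u) [AddCommGroup Q] [Module B Q] (g : M →ₛₗ[ρ] Q),
    (∃ g' : N →ₗ[B] Q, ∀ m, g' (p m) = g m) ∧
      ∀ g₁ g₂ : N →ₗ[B] Q, (∀ m, g₁ (p m) = g₂ (p m)) → g₁ = g₂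

/-! ### Sections of a pullback as an extension of scalars -/

section

variable {W X : Scheme.{u}}

/-- The global sections of the sheaf associated to a module. -/
def tildeSections {B : CommRingCat.{u}} (Q : ModuleCat.{u} B) :
    Q ≃+ Γ(tilde Q, ⊤) := (tilde.isoTop Q).toLinearEquiv.toAddEquiv

lemma smul_top_Spec {B : CommRingCat.{u}} (E : (Spec B).Modules) (b : B) (s : Γ(E, ⊤)) :
    b • s = ((Scheme.ΓSpecIso B).inv b :) • s := by
  refine (Scheme.Modules.smul_Spec_def b s).trans ?_
  congr 1

lemma tildeSections_smul {B : CommRingCat.{u}} (Q : ModuleCat.{u} B) (b : B) (q : Q) :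
    tildeSections Q (b • q) = ((Scheme.ΓSpecIso B).inv b :) • tildeSections Q q :=
  (map_smul (tilde.isoTop Q).toLinearEquiv b q).trans (smul_top_Spec (tilde Q) b _)

lemma tildeSections_symm_smul {B : CommRingCat.{u}} (Q : ModuleCat.{u} B) (b : B)
    (s : Γ(tilde Q, ⊤)) :
    (tildeSections Q).symm (((Scheme.ΓSpecIso B).inv b :) • s) = b • (tildeSections Q).symm s := by
  rw [AddEquiv.symm_apply_eq, tildeSections_smul, AddEquiv.apply_symm_apply]

/-- A semilinear map from `Γ(M, U)` to `Q` is the same as a morphism from `M` to the pushforward of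
the sheaf `E` associated to `Q` along `Spec Γ(W, V) → W → X`. The adjunction of pullback and
pushforward turns it into a morphism out of `f^* M`, which is a linear map on sections over `V`. -/
theorem isExtension_pullSec (f : W ⟶ X) {M : X.Modules} (hM : M.IsQuasicoherent) {U : X.Opens}
    {V : W.Opens} (hU : IsAffineOpen U) (hV : IsAffineOpen V) (h : V ≤ f ⁻¹ᵁ U) :
    IsExtension (f.appLE U V h).hom (pullSec f M h) := by
  have hM' := localizes_of_isQuasicoherent M hM
  have hfM := localizes_of_isQuasicoherent _ (isQuasicoherent_pullback f hM)
  have e := hU.SpecMap_appLE_fromSpec f hV h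
  have hpre : hV.fromSpec ⁻¹ᵁ V = ⊤ := hV.fromSpec_preimage_self
  have hle : hV.fromSpec ⁻¹ᵁ V ≤ hV.fromSpec ⁻¹ᵁ (f ⁻¹ᵁ U) := fun _ hx ↦ h hx
  intro Q _ _ g
  let Q' : ModuleCat Γ(W, V) := ModuleCat.of _ Q
  let E := tilde Q'
  constructor
  · obtain ⟨Ψ, hΨ⟩ := exists_hom_pushforward hM' hU (Spec.map (f.appLE U V h))
      (hV.fromSpec ≫ f) e.symm E
      ((tildeSections Q').toAddMonoidHom.comp g.toAddMonoidHom) (by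
        intro r s
        have e₁ : g (r • s) = ((f.appLE U V h).hom r • (g s : Q') : Q') := g.map_smulₛₗ r s
        refine (congrArg (tildeSections Q') e₁).trans ((tildeSections_smul Q' _ _).trans ?_)
        congr 1
        exact congr($(Scheme.ΓSpecIso_inv_naturality (f.appLE U V h)) r))
    let Ψ' := Ψ ≫ (Scheme.Modules.pushforwardComp hV.fromSpec f).inv.app E
    let Ξ := ((Scheme.Modules.pullbackPushforwardAdjunction f).homEquiv _ _).symm Ψ'
    refine ⟨{ toFun s := (tildeSections Q').symm (res E hpre.ge (appL Ξ V s))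
              map_add' s t := by 
                rw [map_add]
                exact (congrArg _ (map_add (res E hpre.ge) _ _)).trans
                  (map_add (tildeSections Q').symm _ _)
              map_smul' b s := by
                refine Eq.trans ?_ (tildeSections_symm_smul Q' b _)
                rw [map_smul]
                refine congrArg _ ((res_smul (M := E) hpre.ge _ _).trans ?_)
                refine congrArg (fun c : Γ(Spec Γ(W, V), ⊤) ↦ c • res E hpre.ge (appL Ξ V s)) ?_
                refine (congrArg (resO hpre.ge) congr($(hV.fromSpec_app_self).hom b)).trans ?_
                exact (resO_resO (X := Spec Γ(W, V)) hpre.le hpre.ge _).trans (resO_self _) }, fun m ↦ ?_⟩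
    refine (AddEquiv.symm_apply_eq _).2 (Eq.trans ?_ (hΨ (hpre.ge.trans hle) m))
    refine (congrArg (res E hpre.ge) (appL_pullSec_adj f Ξ h m)).trans ?_
    rw [Equiv.apply_symm_apply]
    exact res_res (M := E) hle hpre.ge _
  · intro g₁ g₂ hg
    -- For uniqueness both linear maps are extended to morphisms, which is possible because `f^* M`
    -- is quasi-coherent. Their transposes agree on `Γ(M, U)`, and this determines them because the
    -- image of `Spec Γ(W, V)` lies in `U`.
    have ext (g₁ : Γ((Scheme.Modules.pullback f).obj M, V) →ₗ[Γ(W, V)] Q) :=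
      exists_hom_pushforward hfM hV (𝟙 _) hV.fromSpec (Category.id_comp _).symm E
        ((tildeSections Q').toAddMonoidHom.comp g₁.toAddMonoidHom) (by
        intro r s
        refine (congrArg (tildeSections Q') (g₁.map_smul r s)).trans ?_
        exact (tildeSections_smul Q' _ _))
    obtain ⟨Ξ₁, h₁⟩ := ext g₁
    obtain ⟨Ξ₂, h₂⟩ := ext g₂
    have key : Ξ₁ = Ξ₂ := by
      apply ((Scheme.Modules.pullbackPushforwardAdjunction f).homEquiv _ _).injective
      rw [← cancel_mono ((Scheme.Modules.pushforwardComp hV.fromSpec f).hom.app E)]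
      refine hom_pushforward_ext hM' ⟨U, hU⟩ _ ?_ E _ _ fun s ↦ ?_
      · exact fun z ↦ h (hpre.ge (Set.mem_univ z))
      refine (res_bijective_of_eq E hle (le_antisymm hle (le_top.trans hpre.ge))).1 ?_
      have a₁ := appL_pullSec_adj f Ξ₁ h s
      have a₂ := appL_pullSec_adj f Ξ₂ h s
      refine a₁.symm.trans (Eq.trans ?_ a₂)
      refine (res_bijective_of_eq E hpre.ge hpre.symm).1 ?_
      refine (h₁ hpre.ge _).trans (Eq.trans ?_ (h₂ hpre.ge _).symm)
      exact congrArg (tildeSections Q') (hg s)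
    ext s
    apply (tildeSections Q').injective
    refine (h₁ hpre.ge s).symm.trans ?_
    rw [key]
    exact h₂ hpre.ge s

end

/-! ### Extension of scalars along flat ring maps -/

section Algebra

open scoped TensorProduct

variable {A B : Type u} [CommRing A] [CommRing B] {ρ : A →+* B}

section

variable {M N : Type u} [AddCommGroup M] [AddCommGroup N] [Module A M] [Module B N]
  {p : M →ₛₗ[ρ] N}

/-- The quotient map by this span and the zero map agree on `p`, so uniqueness makes them equal. -/
lemma IsExtension.span_range (hp : IsExtension ρ p) : Submodule.span B (Set.range p) = ⊤ := by
  have := (hp (N ⧸ Submodule.span B (Set.range p)) 0).2 (Submodule.mkQ _) 0 fun m ↦ by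
    simpa using Submodule.subset_span (Set.mem_range_self m)
  rw [← Submodule.ker_mkQ (Submodule.span B (Set.range p)), this, LinearMap.ker_zero]

lemma IsExtension.prod {M' N' : Type u} [AddCommGroup M'] [AddCommGroup N'] [Module A M']
    [Module B N'] {p' : M' →ₛₗ[ρ] N'} (hp : IsExtension ρ p) (hp' : IsExtension ρ p') :
    IsExtension ρ ({
      toFun := fun m ↦ (p m.1, p' m.2)
      map_add' := fun m m' ↦ by simp
      map_smul' := fun r m ↦ by simp } : M × M' →ₛₗ[ρ] N × N') := by
  intro Q _ _ g
  constructor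
  · obtain ⟨g₁, h₁⟩ := (hp Q (g.comp (LinearMap.inl A M M'))).1
    obtain ⟨g₂, h₂⟩ := (hp' Q (g.comp (LinearMap.inr A M M'))).1
    refine ⟨g₁.coprod g₂, fun m ↦ ?_⟩
    have : g m = g (m.1, 0) + g (0, m.2) := by rw [← map_add]; simp
    simpa [h₁, h₂] using this.symm
  · intro g₁ g₂ h
    refine LinearMap.prod_ext ?_ ?_
    · exact (hp Q (g.comp (LinearMap.inl A M M'))).2 _ _ fun m ↦ by simpa using h (m, 0)
    · exact (hp' Q (g.comp (LinearMap.inr A M M'))).2 _ _ fun m ↦ by simpa using h (0, m)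

lemma IsExtension.quotient (hp : IsExtension ρ p) (K : Submodule A M) (K' : Submodule B N)
    (hK : K' = Submodule.span B (p '' K)) :
    ∃ q : M ⧸ K →ₛₗ[ρ] N ⧸ K', IsExtension ρ q ∧ ∀ m, q (K.mkQ m) = K'.mkQ (p m) := by
  have hle : K ≤ LinearMap.ker (K'.mkQ.comp p) := fun m hm ↦ by
    simpa [hK] using Submodule.subset_span (Set.mem_image_of_mem p hm)
  refine ⟨K.liftQ (K'.mkQ.comp p) hle, fun Q _ _ g ↦ ⟨?_, fun g₁ g₂ h ↦ ?_⟩, fun m ↦ rfl⟩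
  · obtain ⟨g', h'⟩ := (hp Q (g.comp K.mkQ)).1
    refine ⟨K'.liftQ g' ?_, fun m ↦ ?_⟩
    · rw [hK, Submodule.span_le]
      rintro _ ⟨m, hm, rfl⟩
      rw [SetLike.mem_coe, LinearMap.mem_ker, h']
      simp [(Submodule.Quotient.mk_eq_zero K).2 hm]
    · obtain ⟨m, rfl⟩ := K.mkQ_surjective m
      exact h' m
  · refine Submodule.linearMap_qext _ ((hp Q (g.comp K.mkQ)).2 _ _ fun m ↦ ?_)
    exact h (K.mkQ m)

end

lemma isExtension_self (ρ : A →+* B) :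
    IsExtension ρ ({ ρ with map_smul' := fun r s ↦ by simp } : A →ₛₗ[ρ] B) := by
  intro Q _ _ g
  refine ⟨⟨LinearMap.toSpanSingleton B Q (g 1), fun m ↦ ?_⟩, fun g₁ g₂ h ↦ ?_⟩
  · change ρ m • g 1 = _
    rw [← map_smulₛₗ, smul_eq_mul, mul_one]
  · ext
    have h₁ : g₁ (ρ 1) = g₂ (ρ 1) := h 1
    simpa using h₁

section

variable {M N P P' : Type u} [AddCommGroup M] [AddCommGroup N] [Module A M] [Module B N]
  [AddCommGroup P] [AddCommGroup P'] [Module A P] [Module B P']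
  {p : M →ₛₗ[ρ] N} {q : P →ₛₗ[ρ] P'}

/-- Flat extensions preserve kernels. -/
lemma IsExtension.ker_le (hρ : ρ.Flat) (hp : IsExtension ρ p) (hq : IsExtension ρ q)
    (φ : M →ₗ[A] P) (φ' : N →ₗ[B] P') (h : ∀ m, φ' (p m) = q (φ m)) :
    LinearMap.ker φ' ≤ Submodule.span B (p '' LinearMap.ker φ) := by
  algebraize [ρ]
  let _ : Module A N := Module.compHom N ρ
  have : IsScalarTower A B N := .of_algebraMap_smul fun _ _ ↦ rfl
  have : Module.Flat A B := hρ
  have unit (M : Type u) [AddCommGroup M] [Module A M] :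
      ∃ i : M →ₛₗ[ρ] TensorProduct A B M, ∀ m, i m = 1 ⊗ₜ m :=
    ⟨{ toFun := fun m ↦ 1 ⊗ₜ m
       map_add' := fun m m' ↦ TensorProduct.tmul_add _ _ _
       map_smul' := fun r m ↦ by
        rw [TensorProduct.tmul_smul, ← algebraMap_smul B r]
        rfl }, fun m ↦ rfl⟩
  obtain ⟨i, hi⟩ := unit M
  obtain ⟨i', hi'⟩ := unit P
  -- Only a map `e` from `N` to `B ⊗ M` with left inverse `l` is needed, not the full isomorphism.
  obtain ⟨e, he⟩ := (hp _ i).1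
  obtain ⟨e', he'⟩ := (hq _ i').1
  let p₀ : M →ₗ[A] N := { p with map_smul' := fun r m ↦ p.map_smulₛₗ r m }
  let l : TensorProduct A B M →ₗ[B] N := p₀.liftBaseChange B
  have hl : l ∘ₗ e = LinearMap.id := (hp _ p).2 _ _ fun m ↦ by
    simp only [LinearMap.comp_apply, he, hi]
    simp [l, p₀]
  have hc : φ.baseChange B ∘ₗ e = e' ∘ₗ φ' := (hp _ (i'.comp φ)).2 _ _ fun m ↦ by
    simp [he, hi, h, he', hi']
  intro x hx
  have hx' : φ.lTensor B (e x) = 0 := by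
    refine (DFunLike.congr_fun hc x).trans ?_
    simp [LinearMap.mem_ker.1 hx]
  -- By flatness `B ⊗ ker φ → B ⊗ M → B ⊗ P` is exact in the middle.
  obtain ⟨y, hy⟩ := (Module.Flat.lTensor_exact B φ.exact_subtype_ker_map (e x)).1 hx'
  have hx'' : x = l ((LinearMap.ker φ).subtype.lTensor B y) := by
    rw [hy]
    exact (DFunLike.congr_fun hl x).symm
  rw [hx'']
  clear hx'' hy
  induction y with
  | zero => simp
  | add y z hy hz =>
    rw [map_add, map_add]
    exact add_mem hy hz
  | tmul b k =>
    simp only [LinearMap.lTensor_tmul, l, LinearMap.liftBaseChange_tmul]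
    exact Submodule.smul_mem _ _ (Submodule.subset_span ⟨k.1, k.2, rfl⟩)

/-- Flat extensions of submodules commute with intersections. -/
lemma IsExtension.span_inf (hρ : ρ.Flat) (hp : IsExtension ρ p) (K L : Submodule A M) :
    Submodule.span B (p '' K) ⊓ Submodule.span B (p '' L) =
      Submodule.span B (p '' ((K ⊓ L : Submodule A M) : Set M)) := by
  refine le_antisymm ?_ (le_inf (Submodule.span_mono (Set.image_mono inf_le_left))
    (Submodule.span_mono (Set.image_mono inf_le_right)))
  obtain ⟨q, hq, hq'⟩ := hp.quotient K _ rfl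
  obtain ⟨q', hr, hr'⟩ := hp.quotient L _ rfl
  -- `K ⊓ L` is the kernel of `M → M / K × M / L`.
  have := hp.ker_le hρ (hq.prod hr) (K.mkQ.prod L.mkQ)
    ((Submodule.mkQ _).prod (Submodule.mkQ _)) fun m ↦ by
      exact Prod.ext (hq' m).symm (hr' m).symm
  simpa [LinearMap.ker_prod] using this

/-- Flat extensions commute with the formation of `K : m`. -/
lemma IsExtension.colon_singleton_le (hρ : ρ.Flat) (hp : IsExtension ρ p) (K : Submodule A M)
    (m : M) (b : B) (hb : b • p m ∈ Submodule.span B (p '' K)) :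
    b ∈ (K.colon {m}).map ρ := by
  obtain ⟨q, hq, hq'⟩ := hp.quotient K _ rfl
  -- `K : m` is the kernel of `A → M / K`, `a ↦ a m`.
  have := (isExtension_self ρ).ker_le hρ hq (K.mkQ ∘ₗ LinearMap.toSpanSingleton A M m)
    ((Submodule.mkQ _) ∘ₗ LinearMap.toSpanSingleton B N (p m)) fun a ↦ by
      have : q (K.mkQ (a • m)) = Submodule.mkQ _ (p (a • m)) := hq' (a • m)
      rw [p.map_smulₛₗ] at this
      exact this.symm
  have h' := this (x := b) (LinearMap.mem_ker.2 ((Submodule.Quotient.mk_eq_zero _).2 hb))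
  refine Submodule.span_mono (Set.image_mono ?_) h'
  intro a ha
  exact Submodule.mem_colon_singleton.2 ((Submodule.Quotient.mk_eq_zero _).1 ha)

/-- Flat extensions of ideals commute with finite intersections. -/
lemma map_finset_inf (hρ : ρ.Flat) {ι : Type*} (s : Finset ι) (I : ι → Ideal A) :
    s.inf (fun i ↦ (I i).map ρ) ≤ (s.inf I).map ρ := by
  classical
  induction s using Finset.induction_on with
  | empty => simp [Ideal.map_top]
  | insert i s hi ih =>
    rw [Finset.inf_insert, Finset.inf_insert]
    refine (inf_le_inf_left _ ih).trans (((isExtension_self ρ).span_inf hρ _ _).le)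

/-- Flat extensions commute with the formation of `K : M`, for finite `M`. -/
lemma IsExtension.colon_span [Module.Finite A M] (hρ : ρ.Flat) (hp : IsExtension ρ p)
    (K : Submodule A M) :
    (Submodule.span B (p '' K)).colon Set.univ = (K.colon Set.univ).map ρ := by
  refine le_antisymm (fun b hb ↦ ?_) (Ideal.map_le_iff_le_comap.2 fun a ha ↦ ?_)
  · obtain ⟨s, hs⟩ := Module.Finite.fg_top (R := A) (M := M)
    -- Finite generation makes `K : M` a finite intersection, as flat extension commutes only with
    -- finite ones in general.
    have e : K.colon Set.univ = s.inf fun m ↦ K.colon {m} := by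
      ext a
      rw [← Submodule.top_coe (R := A) (M := M), ← hs, Submodule.colon_span,
        Submodule.mem_colon]
      simp [Submodule.mem_finsetInf, Submodule.mem_colon_singleton]
    rw [e]
    refine map_finset_inf hρ s _ ?_
    simp only [Submodule.mem_finsetInf]
    intro m _
    exact hp.colon_singleton_le hρ K m b (Submodule.mem_colon.1 hb _ trivial)
  · rw [Ideal.mem_comap, Submodule.mem_colon]
    rintro n -
    have hn : n ∈ Submodule.span B (Set.range p) := by rw [hp.span_range]; trivial
    induction hn using Submodule.span_induction with
    | mem _ h =>
      obtain ⟨m, rfl⟩ := h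
      rw [← map_smulₛₗ]
      exact Submodule.subset_span ⟨_, Submodule.mem_colon.1 ha m trivial, rfl⟩
    | zero => simp
    | add _ _ _ _ h h' => rw [smul_add]; exact add_mem h h'
    | smul c _ _ h => rw [smul_comm]; exact Submodule.smul_mem _ _ h

end

end Algebra

/-- A consequence of the Artin–Rees lemma. -/
lemma exists_inf_sup_pow_le {A M : Type*} [CommRing A] [IsNoetherianRing A] [AddCommGroup M]
    [Module A M] [Module.Finite A M] (I : Ideal A) (N L : Submodule A M) (h : I • L ≤ N) :
    ∃ k : ℕ, ∀ m ≥ k, L ⊓ (N ⊔ I ^ m • ⊤) ≤ N := by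
  -- Artin–Rees is applied to the image of `L` in `M / N`, which `I` annihilates. The bound `k + 1`
  -- leaves at least one factor `I` in `I ^ (m - k)`.
  obtain ⟨k, hk⟩ := I.exists_pow_inf_eq_pow_smul (L.map N.mkQ)
  refine ⟨k + 1, fun m hm x hx ↦ ?_⟩
  obtain ⟨y, hy, z, hz, rfl⟩ := Submodule.mem_sup.1 hx.2
  have hz' : N.mkQ z ∈ I ^ m • (⊤ : Submodule A (M ⧸ N)) ⊓ L.map N.mkQ := by
    refine ⟨?_, ⟨y + z, hx.1, by simp [hy]⟩⟩
    have := Submodule.mem_map_of_mem (f := N.mkQ) hz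
    rw [Submodule.map_smul''] at this
    exact Submodule.smul_mono le_rfl le_top this
  rw [hk m (by omega)] at hz'
  have h0 : I ^ (m - k) • (I ^ k • ⊤ ⊓ L.map N.mkQ) ≤ ⊥ := by
    calc _ ≤ I • L.map N.mkQ :=
          Submodule.smul_mono (Ideal.pow_le_self (by omega)) inf_le_right
      _ = (I • L).map N.mkQ := (Submodule.map_smul'' _ _ _).symm
      _ ≤ N.map N.mkQ := Submodule.map_mono h
      _ = ⊥ := by simp
  exact add_mem hy (by simpa using h0 hz')

/-! ### Quasi-coherent ideals -/

section IdealSheaf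

variable {X W : Scheme.{u}}

lemma comap_ι_ideal_top (I : X.IdealSheafData) (U : X.affineOpens) :
    have := U.2
    (I.comap U.1.ι).ideal ⟨⊤, isAffineOpen_top U.1.toScheme⟩ =
      (I.ideal U).comap U.1.topIso.hom.hom := by
  intro _
  rw [Scheme.IdealSheafData.ideal_comap_of_isOpenImmersion]
  have key : ∀ (V : X.affineOpens) (e : V.1 = U.1),
      I.ideal V = (I.ideal U).comap (X.presheaf.map (eqToHom e.symm).op).hom := by
    intro V e
    obtain rfl : V = U := Subtype.ext e
    ext
    simp
  refine (congrArg (Ideal.comap _) (key _ U.1.ι_image_top)).trans ?_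
  rw [Ideal.comap_comap, Scheme.Opens.ι_appIso]
  rfl

lemma map_le_ideal_comap (f : W ⟶ X) (I : X.IdealSheafData) (U : X.affineOpens)
    (V : W.affineOpens) (h : V.1 ≤ f ⁻¹ᵁ U.1) :
    (I.ideal U).map (f.appLE U.1 V.1 h).hom ≤ (I.comap f).ideal V := by
  refine Ideal.map_le_iff_le_comap.2 fun r hr ↦ ?_
  have h₁ := Scheme.Hom.ideal_ker_le _ _ (Scheme.IdealSheafData.le_map_comap (f := f) (J := I) U hr)
  rw [Ideal.mem_comap, ← Scheme.IdealSheafData.ker_subschemeι_app]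
  have h₂ := congrArg (resO (X := (I.comap f).subscheme)
    (show (I.comap f).subschemeι ⁻¹ᵁ V.1 ≤ (I.comap f).subschemeι ⁻¹ᵁ (f ⁻¹ᵁ U.1) from
      fun _ hx ↦ h hx)) h₁
  refine Eq.trans ?_ (h₂.trans (map_zero _))
  rw [Scheme.Hom.comp_app]
  simp only [Scheme.Hom.appLE, CommRingCat.hom_comp, RingHom.comp_apply]
  exact congr($((I.comap f).subschemeι.naturality (homOfLE h).op).hom ((f.app U.1).hom r))

/-- The extension of a quasi-coherent ideal on affine open sets. -/
lemma ideal_comap (f : W ⟶ X) (I : X.IdealSheafData) (U : X.affineOpens)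
    (V : W.affineOpens) (h : V.1 ≤ f ⁻¹ᵁ U.1) :
    (I.comap f).ideal V = (I.ideal U).map (f.appLE U.1 V.1 h).hom := by
  refine le_antisymm ?_ (map_le_ideal_comap f I U V h)
  have := U.2
  have := V.2
  -- For the reverse inclusion, `J` is the ideal on `V` defined by the extended ideal. By the
  -- adjunction of `comap` and `map`, `I.comap (V.1.ι ≫ f) ≤ J` reduces to global sections over `U`.
  let J : Scheme.IdealSheafData V.1.toScheme := Scheme.IdealSheafData.ofIdealTop
    (((I.ideal U).map (f.appLE U.1 V.1 h).hom).comap V.1.topIso.hom.hom)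
  have hJ : J.ideal ⟨⊤, isAffineOpen_top _⟩ =
      ((I.ideal U).map (f.appLE U.1 V.1 h).hom).comap V.1.topIso.hom.hom := by
    exact Scheme.IdealSheafData.equivOfIsAffine.right_inv _
  have key : I.comap (V.1.ι ≫ f) ≤ J := by
    rw [← Scheme.Hom.resLE_comp_ι f h, Scheme.IdealSheafData.comap_comp,
      ← Scheme.IdealSheafData.le_map_iff_comap_le]
    refine Scheme.IdealSheafData.le_of_isAffine ?_
    rw [comap_ι_ideal_top, Scheme.IdealSheafData.ideal_map_of_isAffineHom]
    intro x hx
    rw [Ideal.mem_comap]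
    have : ∀ y ∈ ((I.ideal U).map (f.appLE U.1 V.1 h).hom).comap V.1.topIso.hom.hom,
       y ∈ J.ideal ⟨⊤, isAffineOpen_top _⟩ := hJ.ge
    refine this _ ?_
    have e : (f.resLE U.1 V.1 h).app ⊤ =
      U.1.topIso.hom ≫ f.appLE U.1 V.1 h ≫ V.1.topIso.inv := Scheme.Hom.resLE_app_top _ _
    have e' : V.1.topIso.hom.hom (((f.resLE U.1 V.1 h).app ⊤).hom x) =
        (f.appLE U.1 V.1 h).hom (U.1.topIso.hom.hom x) := by
      refine (congrArg V.1.topIso.hom.hom congr($(e).hom x)).trans ?_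
      exact V.1.topIso.commRingCatIsoToRingEquiv.apply_symm_apply _
    refine Ideal.mem_comap.2 ?_
    refine e' ▸ ?_
    exact Ideal.mem_map_of_mem _ hx
  rw [Scheme.IdealSheafData.comap_comp] at key
  have key' := key ⟨⊤, isAffineOpen_top _⟩
  rw [hJ, comap_ι_ideal_top] at key'
  intro x hx
  obtain ⟨y, rfl⟩ : ∃ y, V.1.topIso.hom.hom y = x :=
    V.1.topIso.commRingCatIsoToRingEquiv.surjective x
  exact key' hx

/-- The ideal is the kernel of the map to the functions on `U ∩ V(p)`, a domain unless `U` misses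
`V(p)`. -/
lemma ideal_isPrime_or_top (p : X.IdealSheafData) [IsIntegral p.subscheme] (U : X.affineOpens) :
    (p.ideal U).IsPrime ∨ p.ideal U = ⊤ := by
  rw [← Scheme.IdealSheafData.ker_subschemeι_app]
  by_cases h : Nonempty (p.subschemeι ⁻¹ᵁ U.1)
  · left
    have : IsDomain Γ(p.subscheme, p.subschemeι ⁻¹ᵁ U.1) := inferInstance
    exact RingHom.ker_isPrime _
  · right
    have : p.subschemeι ⁻¹ᵁ U.1 = ⊥ := by
      ext x
      exact ⟨fun hx ↦ (h ⟨x, hx⟩).elim, fun hx ↦ hx.elim⟩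
    have : Subsingleton Γ(p.subscheme, p.subschemeι ⁻¹ᵁ U.1) := by
      rw [this]; infer_instance
    exact RingHom.ker_eq_top_of_subsingleton _

lemma le_of_pow_le {p I : X.IdealSheafData} [IsIntegral p.subscheme] {m : ℕ}
    (h : ∀ U, I.ideal U ^ m ≤ p.ideal U) : I ≤ p := by
  intro U
  rcases ideal_isPrime_or_top p U with hp | hp
  · exact hp.le_of_pow_le (h U)
  · rw [hp]; exact le_top

lemma mem_ideal_of_res_mem {p : X.IdealSheafData} [IsIntegral p.subscheme] {U V : X.affineOpens}
    (h : V.1 ≤ U.1) (hV : Nonempty (p.subschemeι ⁻¹ᵁ V.1)) {r : Γ(X, U)}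
    (hr : resO h r ∈ p.ideal V) : r ∈ p.ideal U := by
  rw [← Scheme.IdealSheafData.ker_subschemeι_app] at hr ⊢
  have hle : p.subschemeι ⁻¹ᵁ V.1 ≤ p.subschemeι ⁻¹ᵁ U.1 := fun _ hx ↦ h hx
  have := hV
  refine map_injective_of_isIntegral p.subscheme (homOfLE hle) ?_
  rw [map_zero]
  exact congr($(p.subschemeι.naturality (homOfLE h).op).hom r).symm.trans hr

/-- The failures of `I ≤ p` and `J ≤ p` may be visible on different affine opens. Irreducibility of
`V(p)` gives an affine open inside both that meets `V(p)`, and by integrality both failures persist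
there. -/
lemma le_or_le_of_inf_le {p I J : X.IdealSheafData} [IsIntegral p.subscheme]
    (h : I ⊓ J ≤ p) : I ≤ p ∨ J ≤ p := by
  by_contra! hc
  obtain ⟨hI, hJ⟩ := hc
  have key : ∀ K : X.IdealSheafData, ¬ K ≤ p → ∃ (U : X.affineOpens) (r : Γ(X, U)),
      r ∈ K.ideal U ∧ r ∉ p.ideal U ∧ Nonempty (p.subschemeι ⁻¹ᵁ U.1) := by
    intro K hK
    simp only [Scheme.IdealSheafData.le_def, not_forall] at hK
    obtain ⟨U, hU⟩ := hK
    obtain ⟨r, hr, hr'⟩ := SetLike.not_le_iff_exists.1 hU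
    refine ⟨U, r, hr, hr', ?_⟩
    by_contra h
    have : p.subschemeι ⁻¹ᵁ U.1 = ⊥ := by
      ext x
      exact ⟨fun hx ↦ (h ⟨x, hx⟩).elim, fun hx ↦ hx.elim⟩
    have : Subsingleton Γ(p.subscheme, p.subschemeι ⁻¹ᵁ U.1) := by
      rw [this]; infer_instance
    rw [← Scheme.IdealSheafData.ker_subschemeι_app] at hr'
    exact hr' (Subsingleton.elim _ _)
  obtain ⟨U, r, hr, hrp, ⟨x, hx⟩⟩ := key I hI
  obtain ⟨U', r', hr', hrp', ⟨x', hx'⟩⟩ := key J hJ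
  obtain ⟨y, hy, hy'⟩ := nonempty_preirreducible_inter
    (p.subschemeι ⁻¹ᵁ U.1).isOpen (p.subschemeι ⁻¹ᵁ U'.1).isOpen ⟨x, hx⟩ ⟨x', hx'⟩
  obtain ⟨V, hyV, hV⟩ := exists_affine_le (X := X) (U := U.1 ⊓ U'.1)
    (x := p.subschemeι y) ⟨hy, hy'⟩
  have hne : Nonempty (p.subschemeι ⁻¹ᵁ V.1) := ⟨⟨y, hyV⟩⟩
  have h₁ := mt (mem_ideal_of_res_mem (hV.trans inf_le_left) hne) hrp
  have h₂ := mt (mem_ideal_of_res_mem (hV.trans inf_le_right) hne) hrp'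
  have h₃ : resO (hV.trans inf_le_left) r * resO (hV.trans inf_le_right) r' ∈ p.ideal V :=
    h V ⟨Ideal.mul_mem_right _ _ (I.ideal_le_comap_ideal (hV.trans inf_le_left) hr),
      Ideal.mul_mem_left _ _ (J.ideal_le_comap_ideal (hV.trans inf_le_right) hr')⟩
  rcases ideal_isPrime_or_top p V with hp | hp
  · exact (hp.mem_or_mem h₃).elim h₁ h₂
  · exact h₁ (hp ▸ trivial)

/-- Ideals of `W` that agree on sufficiently small affine open sets agree. -/
lemma idealSheaf_ext_of_locally {I J : W.IdealSheafData}
    (h : ∀ w : W, ∃ V : W.affineOpens, w ∈ V.1 ∧ I.ideal V = J.ideal V) : I = J := by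
  choose V hV h using h
  exact Scheme.IdealSheafData.ext_of_iSup_eq_top V
    (top_le_iff.1 fun w _ ↦ TopologicalSpace.Opens.mem_iSup.2 ⟨w, hV w⟩) h

lemma comap_pow (f : W ⟶ X) (I : X.IdealSheafData) (m : ℕ) :
    (I ^ m).comap f = I.comap f ^ m := by
  refine idealSheaf_ext_of_locally fun w ↦ ?_
  obtain ⟨U, V, hw, h, -⟩ := exists_affine_le_preimage f w ⊤ trivial
  refine ⟨V, hw, ?_⟩
  rw [Scheme.IdealSheafData.ideal_pow, Pi.pow_apply, ideal_comap f _ U V h,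
    ideal_comap f _ U V h, Scheme.IdealSheafData.ideal_pow, Pi.pow_apply, Ideal.map_pow]

end IdealSheaf

/-! ### `G`-ideals -/

section GIdeal

variable {S : Scheme.{u}} {G X : Over S} [GrpObj G] [ModObj G X]

lemma IsGIdeal.pow {I : X.left.IdealSheafData} (hI : IsGIdeal G I) (m : ℕ) :
    IsGIdeal G (I ^ m) := by
  rw [IsGIdeal, comap_pow, comap_pow, hI]

lemma starIdeal_le (I : X.left.IdealSheafData) : starIdeal G I ≤ I :=
  sSup_le fun _ hJ ↦ hJ.2

lemma IsGIdeal.le_starIdeal {I J : X.left.IdealSheafData} (hJ : IsGIdeal G J) (h : J ≤ I) :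
    J ≤ starIdeal G I :=
  le_sSup ⟨hJ, h⟩

/-- `comap` is a left adjoint, so it commutes with sums of ideals. -/
lemma isGIdeal_starIdeal (I : X.left.IdealSheafData) : IsGIdeal G (starIdeal G I) := by
  rw [IsGIdeal, starIdeal, (Scheme.IdealSheafData.map_gc _).l_sSup,
    (Scheme.IdealSheafData.map_gc _).l_sSup]
  exact iSup_congr fun J ↦ iSup_congr fun hJ ↦ hJ.1

lemma IsGPrime.le_of_pow_le {P I : X.left.IdealSheafData} (hP : IsGPrime G P)
    (hI : IsGIdeal G I) {m : ℕ} (h : I ^ m ≤ P) : I ≤ P := by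
  obtain ⟨-, p, hp, rfl⟩ := hP
  exact hI.le_starIdeal (GPrimary.le_of_pow_le (fun U ↦ (h.trans (starIdeal_le p)) U))

lemma IsGPrime.le_or_le {P I J : X.left.IdealSheafData} (hP : IsGPrime G P)
    (hI : IsGIdeal G I) (hJ : IsGIdeal G J) (h : I ⊓ J ≤ P) : I ≤ P ∨ J ≤ P := by
  obtain ⟨-, p, hp, rfl⟩ := hP
  exact (le_or_le_of_inf_le (h.trans (starIdeal_le p))).imp hI.le_starIdeal hJ.le_starIdeal

lemma IsGIdeal.le_gRadical {I J : X.left.IdealSheafData} (hI : IsGIdeal G I)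
    (h : ∀ P, IsGPrime G P → J ≤ P → I ≤ P) : I ≤ gRadical G J :=
  hI.le_starIdeal (le_sInf fun P hP ↦ h P hP.1 hP.2)

lemma gRadical_le {J P : X.left.IdealSheafData} (hP : IsGPrime G P) (h : J ≤ P) :
    gRadical G J ≤ P :=
  (starIdeal_le _).trans (sInf_le ⟨hP, h⟩)

/-- A `G`-prime that contains `I ⊓ J` contains `I` or `J`, hence in either case the common radical.
-/
lemma gRadical_inf {I J : X.left.IdealSheafData} (hI : IsGIdeal G I) (hJ : IsGIdeal G J)
    (h : gRadical G I = gRadical G J) : gRadical G (I ⊓ J) = gRadical G I := by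
  refine le_antisymm ?_ ?_
  · exact (isGIdeal_starIdeal _).le_gRadical fun P hP hIP ↦
      gRadical_le hP (inf_le_left.trans hIP)
  · refine (isGIdeal_starIdeal _).le_gRadical fun P hP hIJ ↦ ?_
    rcases hP.le_or_le hI hJ hIJ with h' | h'
    · exact gRadical_le hP h'
    · exact h.le.trans (gRadical_le hP h')

end GIdeal

/-! ### Flatness of the action -/

section Flat

variable {S : Scheme.{u}} (G X : Over S) [GrpObj G] [ModObj G X]

/-- The involution `(g, x) ↦ (g⁻¹, g x)`. -/
def shear : G ⊗ X ⟶ G ⊗ X := lift (fst G X ≫ GrpObj.inv) (actOver G X)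

/-- This is `g⁻¹ (g x) = x`: associativity moves the product `g⁻¹ g` into `G`, where it becomes the
unit. -/
lemma shear_actOver : shear G X ≫ actOver G X = snd G X := by
  have h₁ : shear G X = lift (fst G X ≫ GrpObj.inv) (𝟙 _) ≫ G ◁ actOver G X := by
    ext <;> simp [shear]
  have h₂ : (G ◁ actOver G X) ≫ actOver G X =
      (α_ G G X).inv ≫ MonObj.mul (X := G) ▷ X ≫ actOver G X := ModObj.assoc_flip X
  have h₃ : lift (fst G X ≫ GrpObj.inv) (𝟙 _) ≫ (α_ G G X).inv ≫ MonObj.mul (X := G) ▷ X =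
      snd G X ≫ (λ_ X).inv ≫ MonObj.one (X := G) ▷ X := by
    have e₁ : 𝟙 (G ⊗ X) = lift (fst G X) (snd G X) := lift_fst_snd.symm
    have e₂ : snd G X ≫ (λ_ X).inv = lift (toUnit _) (snd G X) :=
      CartesianMonoidalCategory.hom_ext _ _ (toUnit_unique _ _) (by
        rw [Category.assoc, leftUnitor_inv_snd, Category.comp_id, lift_snd])
    rw [e₁, reassoc_of% lift_lift_associator_inv, lift_whiskerRight, GrpObj.lift_comp_inv_left,
      reassoc_of% e₂, lift_whiskerRight]
  have h₄ : MonObj.one (X := G) ▷ X ≫ actOver G X = (λ_ X).hom := ModObj.one_smul X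
  rw [h₁, Category.assoc, h₂, reassoc_of% h₃, h₄]
  simp

lemma shear_shear : shear G X ≫ shear G X = 𝟙 _ := by
  have h : shear G X ≫ lift (fst G X ≫ GrpObj.inv) (actOver G X) = 𝟙 _ := by
    rw [comp_lift, shear_actOver]
    ext <;> simp [shear]
  exact h

/-- The action of a p-flat scheme is flat. -/
lemma flat_act (h : IsPFlat G X) : Flat (act G X) := by
  -- The action is the projection preceded by an automorphism, so it inherits flatness.
  have e : act G X = (shear G X).left ≫ proj G X := by
    rw [act, proj, ← Over.comp_left, shear, lift_snd]
  have : IsIso (shear G X) := ⟨_, shear_shear G X, shear_shear G X⟩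
  have : Flat (proj G X) := h
  have : IsIso (shear G X).left := inferInstanceAs (IsIso ((Over.forget S).map (shear G X)))
  rw [e]
  exact Flat.comp _ _

lemma flat_appLE {W X : Scheme.{u}} (f : W ⟶ X) (hf : Flat f) {U : X.Opens} {V : W.Opens}
    (hU : IsAffineOpen U) (hV : IsAffineOpen V) (h : V ≤ f ⁻¹ᵁ U) :
    (f.appLE U V h).hom.Flat :=
  f.flat_appLE hU hV h

end Flat

/-! ### The ideal `N : M` -/

section Colon

variable {X : Scheme.{u}} {M : X.Modules}

lemma isQCFamily_sections {N : Subobject M}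
    (hN : Localizes (N : X.Modules)) : IsQCFamily fun U : X.affineOpens ↦ sections N U.1 :=
  isQCFamily_range hN N.arrow

/-- `ofIdeals` is in general only the largest ideal sheaf inside the given family. Since `M` is
finitely generated, the colon ideals already commute with localization and nothing is lost. -/
lemma colon_ideal (hM : IsCoherent M) {N : Subobject M} (hN : Localizes (N : X.Modules))
    (U : X.affineOpens) : (colon N).ideal U = (sections N U.1).colon Set.univ := by
  have hM' := localizes_of_isQuasicoherent M hM.1
  have hP := isQCFamily_sections hN
  let I : X.IdealSheafData :=
    { ideal := fun U ↦ (sections N U.1).colon Set.univ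
      map_ideal_basicOpen := ?_ }
  · exact congr($(Scheme.IdealSheafData.ofIdeals_ideal I).ideal U)
  intro U f
  change Ideal.map (resO (X.basicOpen_le f)) ((sections N U.1).colon Set.univ) =
    (sections N (X.basicOpen f)).colon (Set.univ : Set Γ(M, X.basicOpen f))
  refine le_antisymm (Ideal.map_le_iff_le_comap.2 fun c hc ↦ ?_) fun c hc ↦ ?_
  · refine Ideal.mem_comap.2 (Submodule.mem_colon.2 ?_)
    rintro (m : Γ(M, X.basicOpen f)) -
    obtain ⟨n, t, ht⟩ := hM'.exists_pow U f m
    have h₁ := res_mem_sections N (X.basicOpen_le f) (Submodule.mem_colon.1 hc t trivial)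
    rw [res_smul, ht, smul_comm] at h₁
    have hu : IsUnit (resO (X.basicOpen_le f) f ^ n) := (isUnit_resO_basicOpen f).pow n
    exact (Submodule.smul_mem_iff_of_isUnit _ hu).1 h₁
  · obtain ⟨k, c', hc'⟩ := exists_pow_resO U f c
    obtain ⟨s, hs⟩ := (finite_sections hM U).fg_top
    have hn : ∀ m : Γ(M, U), ∃ n : ℕ, f ^ n • c' • m ∈ sections N U.1 := by
      intro m
      have h₁ : res M (X.basicOpen_le f) (c' • m) ∈ sections N (X.basicOpen f) := by
        rw [res_smul, hc', mul_smul]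
        exact Submodule.smul_mem _ _ (Submodule.mem_colon.1 hc _ trivial)
      obtain ⟨n, t, ht, e⟩ := hP.exists_pow U f _ h₁
      have h₂ : res M (X.basicOpen_le f) (t - f ^ n • c' • m) = 0 := by
        rw [map_sub, e, res_smul, res_smul, res_smul, map_pow, sub_self]
      obtain ⟨l, hl⟩ := hM'.exists_pow_zero U f _ h₂
      refine ⟨l + n, ?_⟩
      rw [smul_sub, sub_eq_zero] at hl
      rw [pow_add, mul_smul, ← hl]
      exact Submodule.smul_mem _ _ ht
    choose n hn using hn
    -- One exponent serves all of `Γ(M, U)`: the largest of those for the finitely many generators.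
    have hc₂ : f ^ (s.sup n) * c' ∈ (sections N U.1).colon Set.univ := by
      rw [← Submodule.top_coe (R := Γ(X, U)) (M := Γ(M, U)), ← hs, Submodule.colon_span,
        Submodule.mem_colon]
      intro m hm
      obtain ⟨d, hd⟩ := Nat.exists_eq_add_of_le' (Finset.le_sup (f := n) hm)
      rw [hd, pow_add, mul_assoc, mul_smul, mul_smul]
      exact Submodule.smul_mem _ _ (hn m)
    have hu : IsUnit (resO (X.basicOpen_le f) f ^ (s.sup n + k)) :=
      (isUnit_resO_basicOpen f).pow _
    have h₃ := Ideal.mem_map_of_mem (resO (X.basicOpen_le f)) hc₂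
    rw [map_mul, hc', map_pow, ← mul_assoc, ← pow_add] at h₃
    exact (Ideal.unit_mul_mem_iff_mem _ hu).1 h₃

end Colon

/-! ### Lattice operations on quasi-coherent submodules -/

section Lattice

variable {X : Scheme.{u}} {M : X.Modules}

lemma exists_pow_add {U : X.affineOpens} {f : Γ(X, U)} (Q : Submodule Γ(X, U) Γ(M, U))
    {s s' : Γ(M, X.basicOpen f)}
    (h : ∃ (n : ℕ) (t : Γ(M, U)), t ∈ Q ∧
      res M (X.basicOpen_le f) t = resO (X.basicOpen_le f) f ^ n • s)
    (h' : ∃ (n : ℕ) (t : Γ(M, U)), t ∈ Q ∧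
      res M (X.basicOpen_le f) t = resO (X.basicOpen_le f) f ^ n • s') :
    ∃ (n : ℕ) (t : Γ(M, U)), t ∈ Q ∧
      res M (X.basicOpen_le f) t = resO (X.basicOpen_le f) f ^ n • (s + s') := by
  obtain ⟨n, t, ht, e⟩ := h
  obtain ⟨n', t', ht', e'⟩ := h'
  refine ⟨n + n', f ^ n' • t + f ^ n • t', add_mem (Q.smul_mem _ ht) (Q.smul_mem _ ht'), ?_⟩
  rw [map_add, res_smul, res_smul, e, e', map_pow, map_pow, smul_smul, smul_smul, ← pow_add,
    ← pow_add, smul_add, add_comm n' n]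

lemma IsQCFamily.inf (hM : Localizes M)
    {P Q : ∀ U : X.affineOpens, Submodule Γ(X, U) Γ(M, U)} (hP : IsQCFamily P)
    (hQ : IsQCFamily Q) : IsQCFamily fun U ↦ P U ⊓ Q U where
  res_mem U f t ht := ⟨hP.res_mem U f t ht.1, hQ.res_mem U f t ht.2⟩
  exists_pow U f s hs := by
    obtain ⟨n, t, ht, e⟩ := hP.exists_pow U f s hs.1
    obtain ⟨n', t', ht', e'⟩ := hQ.exists_pow U f s hs.2
    obtain ⟨k, hk⟩ := hM.exists_pow_zero U f (f ^ n' • t - f ^ n • t') (by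
      rw [map_sub, res_smul, res_smul, e, e', map_pow, map_pow, smul_smul, smul_smul, ← pow_add,
        ← pow_add, add_comm n' n, sub_self])
    rw [smul_sub, sub_eq_zero] at hk
    refine ⟨k + n' + n, f ^ k • f ^ n' • t, ⟨?_, ?_⟩, ?_⟩
    · exact Submodule.smul_mem _ _ (Submodule.smul_mem _ _ ht)
    · rw [hk]
      exact Submodule.smul_mem _ _ (Submodule.smul_mem _ _ ht')
    · rw [res_smul, res_smul, e, map_pow, map_pow, smul_smul, smul_smul, ← pow_add, ← pow_add,
        add_assoc]

lemma IsQCFamily.sup {P Q : ∀ U : X.affineOpens, Submodule Γ(X, U) Γ(M, U)} (hP : IsQCFamily P)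
    (hQ : IsQCFamily Q) : IsQCFamily fun U ↦ P U ⊔ Q U where
  res_mem U f t ht := by
    obtain ⟨y, hy, z, hz, rfl⟩ := Submodule.mem_sup.1 ht
    rw [map_add]
    let A : Submodule Γ(X, X.basicOpen f) Γ(M, X.basicOpen f) := P (X.affineBasicOpen f)
    let B : Submodule Γ(X, X.basicOpen f) Γ(M, X.basicOpen f) := Q (X.affineBasicOpen f)
    change _ ∈ A ⊔ B
    exact Submodule.add_mem_sup (hP.res_mem U f y hy) (hQ.res_mem U f z hz)
  exists_pow U f s hs := by
    let A : Submodule Γ(X, X.basicOpen f) Γ(M, X.basicOpen f) := P (X.affineBasicOpen f)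
    let B : Submodule Γ(X, X.basicOpen f) Γ(M, X.basicOpen f) := Q (X.affineBasicOpen f)
    have hs' : s ∈ A ⊔ B := hs
    obtain ⟨y, hy, z, hz, rfl⟩ := Submodule.mem_sup.1 hs'
    obtain ⟨n, t, ht, e⟩ := hP.exists_pow U f y hy
    obtain ⟨n', t', ht', e'⟩ := hQ.exists_pow U f z hz
    exact exists_pow_add _ ⟨n, t, Submodule.mem_sup_left ht, e⟩
      ⟨n', t', Submodule.mem_sup_right ht', e'⟩

lemma exists_pow_ideal (J : X.IdealSheafData) (U : X.affineOpens) (f : Γ(X, U))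
    {r : Γ(X, X.basicOpen f)} (hr : r ∈ J.ideal (X.affineBasicOpen f)) :
    ∃ (n : ℕ) (a : Γ(X, U)), a ∈ J.ideal U ∧
      resO (X.basicOpen_le f) a = resO (X.basicOpen_le f) f ^ n * r := by
  have := U.2.isLocalization_basicOpen f
  rw [← J.map_ideal_basicOpen U f] at hr
  obtain ⟨⟨⟨a, ha⟩, ⟨_, n, rfl⟩⟩, h⟩ :=
    (IsLocalization.mem_map_algebraMap_iff (Submonoid.powers f) Γ(X, X.basicOpen f)).1 hr
  refine ⟨n, a, ha, ?_⟩
  rw [mul_comm, ← map_pow]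
  exact h.symm

lemma isQCFamily_smul_top (hM : Localizes M) (J : X.IdealSheafData) :
    IsQCFamily fun U : X.affineOpens ↦ J.ideal U • (⊤ : Submodule Γ(X, U) Γ(M, U)) where
  res_mem U f t ht := by
    let I : Ideal Γ(X, X.basicOpen f) := J.ideal (X.affineBasicOpen f)
    change _ ∈ I •
      (⊤ : Submodule Γ(X, X.basicOpen f) Γ(M, X.basicOpen f))
    induction ht using Submodule.smul_induction_on' with
    | smul r hr m hm =>
      rw [res_smul]
      exact Submodule.smul_mem_smul
        (J.ideal_le_comap_ideal (U := X.affineBasicOpen f) (X.basicOpen_le f) hr) trivial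
    | add x _ y _ hx hy =>
      rw [map_add]
      exact add_mem hx hy
  exists_pow U f s hs := by
    let I : Ideal Γ(X, X.basicOpen f) := J.ideal (X.affineBasicOpen f)
    have hs' : s ∈ I • (⊤ : Submodule Γ(X, X.basicOpen f) Γ(M, X.basicOpen f)) := hs
    clear hs
    induction hs' using Submodule.smul_induction_on' with
    | smul r hr m hm =>
      obtain ⟨n, a, ha, e⟩ := exists_pow_ideal J U f hr
      obtain ⟨n', t, ht⟩ := hM.exists_pow U f m
      refine ⟨n + n', a • t, Submodule.smul_mem_smul ha trivial, ?_⟩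
      rw [res_smul, e, ht]
      rw [smul_smul, smul_smul, pow_add]
      congr 1
      ring
    | add x _ y _ hx hy => exact exists_pow_add _ hx hy

/-- Allows uniform exponents and indices to be chosen over a finite cover only. On a small `D(f)` in
`U i` a section of `N` is a fraction of one over `U i`, and `f` is invertible there. -/
lemma le_of_cover {N N' : Subobject M} (hN : Localizes (N : X.Modules))
    {ι : Type*} (U : ι → X.affineOpens) (hU : ∀ x : X, ∃ i, x ∈ (U i).1)
    (h : ∀ i, sections N (U i).1 ≤ sections N' (U i).1) : N ≤ N' := by
  have hP := isQCFamily_sections hN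
  refine le_iff_sections.2 fun V s hs ↦ mem_sections_of_locally _ _ fun x hx ↦ ?_
  obtain ⟨i, hi⟩ := hU x
  obtain ⟨g, f, e, hxg⟩ := exists_basicOpen_le_affine_inter V.2 (U i).2 x ⟨hx, hi⟩
  have hle : X.basicOpen f ≤ V.1 := e ▸ X.basicOpen_le g
  refine ⟨X.basicOpen f, hle, e ▸ hxg, ?_⟩
  obtain ⟨n, t, ht, e'⟩ := hP.exists_pow (U i) f _ (res_mem_sections N hle hs)
  have h₁ := res_mem_sections N' (X.basicOpen_le f) (h i ht)
  rw [e'] at h₁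
  exact (Submodule.smul_mem_iff_of_isUnit _ ((isUnit_resO_basicOpen f).pow n)).1 h₁

lemma toSubobject_inf (hM : Localizes M) {N N' : Subobject M}
    (h : IsQCFamily fun U : X.affineOpens ↦ sections N U.1 ⊓ sections N' U.1) :
    h.toSubobject hM = N ⊓ N' := by
  refine le_antisymm (le_inf ?_ ?_) ?_
  · exact le_iff_sections.2 fun U ↦ (h.sections_toSubobject hM U).le.trans inf_le_left
  · exact le_iff_sections.2 fun U ↦ (h.sections_toSubobject hM U).le.trans inf_le_right
  · exact le_iff_sections.2 fun U ↦ (le_inf (sections_mono inf_le_left U)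
      (sections_mono inf_le_right U)).trans (h.sections_toSubobject hM U).ge

lemma sections_inf (hM : Localizes M) {N N' : Subobject M} (hN : Localizes (N : X.Modules))
    (hN' : Localizes (N' : X.Modules)) (U : X.affineOpens) :
    sections (N ⊓ N') U.1 = sections N U.1 ⊓ sections N' U.1 := by
  have h := (isQCFamily_sections hN).inf hM (isQCFamily_sections hN')
  rw [← toSubobject_inf hM h, h.sections_toSubobject hM]

lemma isCoherent_toSubobject [IsLocallyNoetherian X] (hM : IsCoherent M)
    {P : ∀ U : X.affineOpens, Submodule Γ(X, U) Γ(M, U)} (hP : IsQCFamily P) :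
    IsCoherent (hP.toSubobject (localizes_of_isQuasicoherent M hM.1) : X.Modules) := by
  refine isCoherent_of_localizes (localizes_toSubobject _ hP) fun U ↦ ?_
  have := IsLocallyNoetherian.component_noetherian U
  have := finite_sections hM U
  exact Module.Finite.of_injective (appL (hP.toSubobject _).arrow U.1) (appL_injective _ _)

end Lattice

/-! ### Stable submodules on affine open sets -/

section Extension

variable {W X : Scheme.{u}}

/-- The extension of a submodule of the sections of `M` to the sections of `f^* M`. -/
def extSub (f : W ⟶ X) (M : X.Modules) {U : X.Opens} {V : W.Opens} (h : V ≤ f ⁻¹ᵁ U)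
    (Q : Submodule Γ(X, U) Γ(M, U)) :
    Submodule Γ(W, V) Γ((Scheme.Modules.pullback f).obj M, V) :=
  Submodule.span _ (pullSec f M h '' Q)

variable (f : W ⟶ X) {M : X.Modules} {U : X.Opens} {V : W.Opens} (h : V ≤ f ⁻¹ᵁ U)

lemma extSub_top (hM : M.IsQuasicoherent) (hU : IsAffineOpen U) (hV : IsAffineOpen V) :
    extSub f M h ⊤ = ⊤ := by
  rw [extSub, Submodule.top_coe, Set.image_univ]
  exact (isExtension_pullSec f hM hU hV h).span_range

lemma extSub_sup (Q Q' : Submodule Γ(X, U) Γ(M, U)) :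
    extSub f M h (Q ⊔ Q') = extSub f M h Q ⊔ extSub f M h Q' := by
  refine le_antisymm ?_ (sup_le (Submodule.span_mono (Set.image_mono (le_sup_left (a := Q))))
    (Submodule.span_mono (Set.image_mono (le_sup_right (b := Q')))))
  refine Submodule.span_le.2 ?_
  rintro _ ⟨m, hm, rfl⟩
  obtain ⟨y, hy, z, hz, rfl⟩ := Submodule.mem_sup.1 hm
  rw [map_add]
  exact Submodule.add_mem_sup (Submodule.subset_span ⟨y, hy, rfl⟩)
    (Submodule.subset_span ⟨z, hz, rfl⟩)

lemma extSub_smul_top (hM : M.IsQuasicoherent) (hU : IsAffineOpen U) (hV : IsAffineOpen V)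
    (J : Ideal Γ(X, U)) :
    extSub f M h (J • ⊤) = J.map (f.appLE U V h).hom • ⊤ := by
  refine le_antisymm (Submodule.span_le.2 ?_) ?_
  · rintro _ ⟨m, hm, rfl⟩
    refine Submodule.smul_induction_on hm (fun r hr m _ ↦ ?_) fun x y hx hy ↦ ?_
    · rw [(pullSec f M h).map_smulₛₗ]
      exact Submodule.smul_mem_smul (Ideal.mem_map_of_mem _ hr) trivial
    · rw [map_add]
      exact add_mem hx hy
  · rw [← extSub_top f h hM hU hV, extSub, Ideal.map, Submodule.span_smul_span,
      Submodule.span_le]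
    rintro _ ⟨_, ⟨r, hr, rfl⟩, _, ⟨m, hm, rfl⟩, rfl⟩
    refine Submodule.subset_span ⟨r • m, Submodule.smul_mem_smul hr trivial, ?_⟩
    exact (pullSec f M h).map_smulₛₗ r m

lemma extSub_inf (hf : Flat f) (hM : M.IsQuasicoherent) (hU : IsAffineOpen U)
    (hV : IsAffineOpen V) (Q Q' : Submodule Γ(X, U) Γ(M, U)) :
    extSub f M h (Q ⊓ Q') = extSub f M h Q ⊓ extSub f M h Q' :=
  ((isExtension_pullSec f hM hU hV h).span_inf (flat_appLE f hf hU hV h) Q Q').symm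

lemma extSub_colon (hf : Flat f) (hM : IsCoherent M) (hU : IsAffineOpen U)
    (hV : IsAffineOpen V) (Q : Submodule Γ(X, U) Γ(M, U)) :
    (extSub f M h Q).colon Set.univ = (Q.colon Set.univ).map (f.appLE U V h).hom := by
  have := finite_sections hM ⟨U, hU⟩
  exact (isExtension_pullSec f hM.1 hU hV h).colon_span (flat_appLE f hf hU hV h) Q

/-- The sections of `f^* N` are spanned by pulled back sections of `N`, so their image is a span
too. Injectivity of `f^* N → f^* M` plays no role. -/
lemma range_map_arrow {N : Subobject M} (hN : (N : X.Modules).IsQuasicoherent)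
    (hU : IsAffineOpen U) (hV : IsAffineOpen V) :
    LinearMap.range (appL ((Scheme.Modules.pullback f).map N.arrow) V) =
      extSub f M h (sections N U) := by
  rw [LinearMap.range_eq_map, ← extSub_top f h hN hU hV, extSub, Submodule.map_span, extSub]
  congr 1
  rw [Submodule.top_coe, Set.image_univ, ← Set.range_comp, sections_eq_range,
    LinearMap.coe_range, ← Set.range_comp]
  congr 1
  ext s
  exact appL_pullSec f N.arrow h s

lemma sections_image_pullback (hM : M.IsQuasicoherent) {N : Subobject M}
    (hN : (N : X.Modules).IsQuasicoherent) (hU : IsAffineOpen U) (hV : IsAffineOpen V) :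
    sections (imageSubobject ((Scheme.Modules.pullback f).map N.arrow)) V =
      extSub f M h (sections N U) :=
  (sections_imageSubobject (localizes_of_isQuasicoherent _ (isQuasicoherent_pullback _ hM))
    (localizes_of_isQuasicoherent _ (isQuasicoherent_pullback _ hN)) _ ⟨V, hV⟩).trans
    (range_map_arrow f h hN hU hV)

end Extension

lemma ext_sections_of_locally {W : Scheme.{u}} {E : W.Modules} {N N' : Subobject E}
    (h : ∀ (w : W) (T : W.Opens), w ∈ T → ∃ V : W.affineOpens, w ∈ V.1 ∧ V.1 ≤ T ∧
      sections N V.1 = sections N' V.1) : N = N' := by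
  refine ext_sections fun T ↦ le_antisymm (fun s hs ↦ ?_) fun s hs ↦ ?_
  all_goals
    refine mem_sections_of_locally _ _ fun w hw ↦ ?_
    obtain ⟨V, hwV, hV, e⟩ := h w T.1 hw
    refine ⟨V.1, hV, hwV, ?_⟩
  · exact e ▸ res_mem_sections N hV hs
  · exact e ▸ res_mem_sections N' hV hs

lemma exists_small_affine {W X : Scheme.{u}} (f g : W ⟶ X) (w : W) (T : W.Opens) (hw : w ∈ T) :
    ∃ (U U' : X.affineOpens) (V : W.affineOpens), w ∈ V.1 ∧ V.1 ≤ f ⁻¹ᵁ U.1 ∧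
      V.1 ≤ g ⁻¹ᵁ U'.1 ∧ V.1 ≤ T := by
  obtain ⟨U, V, hwV, hV, hVT⟩ := exists_affine_le_preimage f w T hw
  obtain ⟨U', V', hwV', hV', hVV'⟩ := exists_affine_le_preimage g w V.1 hwV
  exact ⟨U, U', V', hwV', hVV'.trans hV, hV', hVV'.trans hVT⟩

section Stable

variable {S : Scheme.{u}} {G X : Over S} [GrpObj G] [ModObj G X] {M : X.left.Modules}

/-- Stability of a family of submodules of the sections over affine open sets. -/
def IsStableFamily (Φ : Linearization G X M)
    (P : ∀ U : X.left.affineOpens, Submodule Γ(X.left, U) Γ(M, U)) : Prop :=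
  ∀ (U U' : X.left.affineOpens) (V : (G ⊗ X).left.affineOpens) (h : V.1 ≤ act G X ⁻¹ᵁ U.1)
    (h' : V.1 ≤ proj G X ⁻¹ᵁ U'.1),
    (extSub (act G X) M h (P U)).map (appL Φ.iso.hom V.1) = extSub (proj G X) M h' (P U')

lemma appL_iso_bijective {W : Scheme.{u}} {E E' : W.Modules} (e : E ≅ E') (V : W.Opens) :
    Function.Bijective (appL e.hom V) := by
  refine ⟨appL_injective _ _, fun s ↦ ⟨appL e.inv V s, ?_⟩⟩
  rw [← appL_comp, e.inv_hom_id]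
  rfl

lemma sections_image_act (hM : M.IsQuasicoherent) (Φ : Linearization G X M)
    {N : Subobject M} (hN : (N : X.left.Modules).IsQuasicoherent) (U : X.left.affineOpens)
    (V : (G ⊗ X).left.affineOpens) (h : V.1 ≤ act G X ⁻¹ᵁ U.1) :
    sections (imageSubobject ((Scheme.Modules.pullback (act G X)).map N.arrow ≫ Φ.iso.hom)) V.1 =
      (extSub (act G X) M h (sections N U.1)).map (appL Φ.iso.hom V.1) := by
  rw [sections_imageSubobject (localizes_of_isQuasicoherent _ (isQuasicoherent_pullback _ hM))
    (localizes_of_isQuasicoherent _ (isQuasicoherent_pullback _ hN)),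
    ← range_map_arrow _ h hN U.2 V.2, ← LinearMap.range_comp]
  rfl

/-- The affine opens that `a` maps into some affine `U` and `p₂` into some affine `U'` form a base
of `G × X`, so images can be compared on them. -/
lemma isStable_iff (hM : M.IsQuasicoherent) (Φ : Linearization G X M)
    {N : Subobject M} (hN : (N : X.left.Modules).IsQuasicoherent) :
    IsStable Φ N ↔ IsStableFamily Φ fun U ↦ sections N U.1 := by
  constructor
  · intro hs U U' V h h'
    rw [← sections_image_act hM Φ hN U V h, ← sections_image_pullback (proj G X) h' hM hN U'.2 V.2, hs]
  · intro hs
    refine ext_sections_of_locally fun w T hw ↦ ?_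
    obtain ⟨U, U', V, hwV, h, h', hVT⟩ := exists_small_affine (act G X) (proj G X) w T hw
    refine ⟨V, hwV, hVT, ?_⟩
    rw [sections_image_act hM Φ hN U V h, sections_image_pullback (proj G X) h' hM hN U'.2 V.2]
    exact hs U U' V h h'

variable {Φ : Linearization G X M}

lemma IsStableFamily.inf (hG : IsPFlat G X) (hM : M.IsQuasicoherent)
    {P Q : ∀ U : X.left.affineOpens, Submodule Γ(X.left, U) Γ(M, U)}
    (hP : IsStableFamily Φ P) (hQ : IsStableFamily Φ Q) :
    IsStableFamily Φ fun U ↦ P U ⊓ Q U := by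
  intro U U' V h h'
  rw [extSub_inf _ h (flat_act G X hG) hM U.2 V.2, extSub_inf _ h' hG hM U'.2 V.2,
    Submodule.map_inf _ (appL_injective _ _), hP U U' V h h', hQ U U' V h h']

lemma IsStableFamily.sup
    {P Q : ∀ U : X.left.affineOpens, Submodule Γ(X.left, U) Γ(M, U)}
    (hP : IsStableFamily Φ P) (hQ : IsStableFamily Φ Q) :
    IsStableFamily Φ fun U ↦ P U ⊔ Q U := by
  intro U U' V h h'
  rw [extSub_sup, extSub_sup, Submodule.map_sup, hP U U' V h h', hQ U U' V h h']

lemma isStableFamily_smul_top (hM : M.IsQuasicoherent) (Φ : Linearization G X M)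
    {J : X.left.IdealSheafData} (hJ : IsGIdeal G J) :
    IsStableFamily Φ fun U ↦ J.ideal U • ⊤ := by
  intro U U' V h h'
  rw [extSub_smul_top _ h hM U.2 V.2, extSub_smul_top _ h' hM U'.2 V.2, Submodule.map_smul'',
    Submodule.map_top, LinearMap.range_eq_top.2 (appL_iso_bijective _ _).2,
    ← ideal_comap _ J U V h, ← ideal_comap _ J U' V h', hJ]

lemma isGIdeal_colon (hG : IsPFlat G X) (hM : IsCoherent M) {N : Subobject M}
    (hN : IsCohGSubmodule Φ N) : IsGIdeal G (colon N) := by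
  have hs := (isStable_iff hM.1 Φ hN.coherent.1).1 hN.stable
  have hN' := localizes_of_isQuasicoherent _ hN.coherent.1
  refine idealSheaf_ext_of_locally fun w ↦ ?_
  obtain ⟨U, U', V, hwV, h, h', -⟩ := exists_small_affine (act G X) (proj G X) w ⊤ trivial
  refine ⟨V, hwV, ?_⟩
  rw [ideal_comap _ _ U V h, ideal_comap _ _ U' V h', colon_ideal hM hN', colon_ideal hM hN',
    ← extSub_colon _ h (flat_act G X hG) hM U.2 V.2, ← extSub_colon _ h' hG hM U'.2 V.2,
    ← hs U U' V h h']
  -- After flat base change both sides are colons in `a^* M` and `p₂^* M`, and the linear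
  -- isomorphism `Φ` carries one to the other.
  ext b
  simp only [Submodule.mem_colon, Set.mem_univ, true_implies]
  have hb := appL_iso_bijective Φ.iso V.1
  constructor
  · intro H s
    obtain ⟨t, rfl⟩ := hb.2 s
    exact ⟨b • t, H t, (appL Φ.iso.hom V.1).map_smul b t⟩
  · intro H t
    obtain ⟨t', ht', e⟩ := H (appL Φ.iso.hom V.1 t)
    rw [← (appL Φ.iso.hom V.1).map_smul b t] at e
    exact hb.1 e ▸ ht'

lemma isCohGSubmodule_toSubobject [IsLocallyNoetherian X.left] (hM : IsCoherent M)
    {P : ∀ U : X.left.affineOpens, Submodule Γ(X.left, U) Γ(M, U)} (hP : IsQCFamily P)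
    (hs : IsStableFamily Φ P) :
    IsCohGSubmodule Φ (hP.toSubobject (localizes_of_isQuasicoherent M hM.1)) := by
  have hc := isCoherent_toSubobject hM hP
  refine ⟨hc, (isStable_iff hM.1 Φ hc.1).2 ?_⟩
  simpa only [hP.sections_toSubobject] using hs

end Stable

/-! ### Existence of primary decompositions -/

section Existence

lemma exists_finite_affine_cover (X : Scheme.{u}) [CompactSpace X] :
    ∃ s : Finset X.affineOpens, ∀ x : X, ∃ U ∈ s, x ∈ U.1 := by
  obtain ⟨s, hs, e⟩ := (isCompact_iff_finite_and_eq_biUnion_affineOpens (X := X) (U := ⊤)).1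
    isCompact_univ
  refine ⟨hs.toFinset, fun x ↦ ?_⟩
  have hx : x ∈ (⊤ : X.Opens) := trivial
  rw [e] at hx
  simpa using hx

variable {S : Scheme.{u}} {G X : Over S} [GrpObj G] [ModObj G X] {M : X.left.Modules}
  {Φ : Linearization G X M}

lemma IsCohGSubmodule.localizes {N : Subobject M} (hN : IsCohGSubmodule Φ N) :
    Localizes (N : X.left.Modules) :=
  localizes_of_isQuasicoherent _ hN.coherent.1

lemma IsCohGSubmodule.isStableFamily (hM : IsCoherent M) {N : Subobject M}
    (hN : IsCohGSubmodule Φ N) : IsStableFamily Φ fun U ↦ sections N U.1 :=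
  (isStable_iff hM.1 Φ hN.coherent.1).1 hN.stable

section

variable [IsLocallyNoetherian X.left]

lemma IsCohGSubmodule.inf (hG : IsPFlat G X) (hM : IsCoherent M) {N N' : Subobject M}
    (hN : IsCohGSubmodule Φ N) (hN' : IsCohGSubmodule Φ N') : IsCohGSubmodule Φ (N ⊓ N') := by
  have hM' := localizes_of_isQuasicoherent M hM.1
  have hP := (isQCFamily_sections hN.localizes).inf hM' (isQCFamily_sections hN'.localizes)
  rw [← toSubobject_inf hM' hP]
  exact isCohGSubmodule_toSubobject hM hP
    ((hN.isStableFamily hM).inf hG hM.1 (hN'.isStableFamily hM))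

lemma isCohGSubmodule_top (hM : IsCoherent M) (Φ : Linearization G X M) :
    IsCohGSubmodule Φ (⊤ : Subobject M) := by
  have hM' := localizes_of_isQuasicoherent M hM.1
  -- `M` is written as its product with the unit ideal, so the results on `J M` apply.
  have hP := isQCFamily_smul_top hM' ⊤
  have e : hP.toSubobject hM' = ⊤ := ext_sections fun U ↦ by
    rw [hP.sections_toSubobject, sections_top]
    exact Submodule.top_smul _
  rw [← e]
  exact isCohGSubmodule_toSubobject hM hP (isStableFamily_smul_top hM.1 Φ (by simp [IsGIdeal]))

lemma exists_sup (hM : IsCoherent M) {N N' : Subobject M}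
    (hN : IsCohGSubmodule Φ N) (hN' : IsCohGSubmodule Φ N') :
    ∃ L : Subobject M, IsCohGSubmodule Φ L ∧
      ∀ U : X.left.affineOpens, sections L U.1 = sections N U.1 ⊔ sections N' U.1 := by
  have hM' := localizes_of_isQuasicoherent M hM.1
  have hP := (isQCFamily_sections hN.localizes).sup (isQCFamily_sections hN'.localizes)
  exact ⟨_, isCohGSubmodule_toSubobject hM hP ((hN.isStableFamily hM).sup (hN'.isStableFamily hM)),
    hP.sections_toSubobject hM'⟩

lemma exists_sup_smul_top (hM : IsCoherent M) {N : Subobject M} (hN : IsCohGSubmodule Φ N)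
    {J : X.left.IdealSheafData} (hJ : IsGIdeal G J) :
    ∃ L : Subobject M, IsCohGSubmodule Φ L ∧
      ∀ U : X.left.affineOpens, sections L U.1 = sections N U.1 ⊔ J.ideal U • ⊤ := by
  have hM' := localizes_of_isQuasicoherent M hM.1
  have hP := (isQCFamily_sections hN.localizes).sup (isQCFamily_smul_top hM' J)
  exact ⟨_, isCohGSubmodule_toSubobject hM hP
    ((hN.isStableFamily hM).sup (isStableFamily_smul_top hM.1 Φ hJ)), hP.sections_toSubobject hM'⟩

lemma colon_inf (hM : IsCoherent M) {N N' : Subobject M}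
    (hN : IsCohGSubmodule Φ N) (hN' : IsCohGSubmodule Φ N') (hG : IsPFlat G X) :
    colon (N ⊓ N') = colon N ⊓ colon N' := by
  have hM' := localizes_of_isQuasicoherent M hM.1
  refine Scheme.IdealSheafData.ext (funext fun U ↦ ?_)
  rw [Scheme.IdealSheafData.ideal_inf, Pi.inf_apply, colon_ideal hM hN.localizes,
    colon_ideal hM hN'.localizes, colon_ideal hM (hN.inf hG hM hN').localizes,
    sections_inf hM' hN.localizes hN'.localizes, Submodule.inf_colon]

/-- A submodule `L` outside `N ⊓ N'` lies outside one of the two, whose radical is also that of the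
intersection. -/
lemma IsGPrimary.inf (hG : IsPFlat G X) (hM : IsCoherent M) {N N' : Subobject M}
    (hN : IsGPrimary Φ N) (hN' : IsGPrimary Φ N')
    (h : gRadical G (colon N) = gRadical G (colon N')) : IsGPrimary Φ (N ⊓ N') := by
  have hr : gRadical G (colon (N ⊓ N')) = gRadical G (colon N) := by
    rw [colon_inf hM hN.submodule hN'.submodule hG]
    exact gRadical_inf (isGIdeal_colon hG hM hN.submodule) (isGIdeal_colon hG hM hN'.submodule) h
  refine ⟨hN.submodule.inf hG hM hN'.submodule,
    fun e ↦ hN.ne_top (top_le_iff.1 (e ▸ inf_le_left)), fun L I hL hI hIL hLN ↦ ?_⟩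
  rw [hr]
  by_cases hLN₁ : L ≤ N
  · rw [h]
    exact hN'.primary L I hL hI (fun U ↦ (hIL U).trans (sections_mono inf_le_right U))
      fun hLN₂ ↦ hLN (le_inf hLN₁ hLN₂)
  · exact hN.primary L I hL hI (fun U ↦ (hIL U).trans (sections_mono inf_le_left U)) hLN₁

end

variable [IsNoetherian X.left]

lemma isGPrimary_of_irreducible (hM : IsCoherent M) {N : Subobject M}
    (hN : IsCohGSubmodule Φ N) (hN' : N ≠ ⊤)
    (h : ∀ L L' : Subobject M, IsCohGSubmodule Φ L → IsCohGSubmodule Φ L' → L ⊓ L' = N →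
      L = N ∨ L' = N) : IsGPrimary Φ N := by
  refine ⟨hN, hN', fun L I hL hI hIL hLN ↦ ?_⟩
  have hM' := localizes_of_isQuasicoherent M hM.1
  -- Irreducibility needs submodules that contain `N`, so `L` is replaced by `L + N`; `I (L + N) ⊆
  -- N` still holds.
  obtain ⟨L', hL', hLs⟩ := exists_sup hM hL hN
  obtain ⟨s, hs⟩ := exists_finite_affine_cover X.left
  have hU : ∀ U : X.left.affineOpens, ∃ k : ℕ, ∀ m ≥ k,
      sections L' U.1 ⊓ (sections N U.1 ⊔ I.ideal U ^ m • ⊤) ≤ sections N U.1 := by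
    intro U
    have := IsLocallyNoetherian.component_noetherian U
    have := finite_sections hM U
    refine exists_inf_sup_pow_le _ _ _ ?_
    rw [hLs, Submodule.smul_sup]
    exact sup_le (hIL U) Submodule.smul_le_right
  choose k hk using hU
  -- `K = N + I^m M`, with `m` the largest Artin–Rees exponent over the finite cover.
  obtain ⟨K, hK, hKs⟩ := exists_sup_smul_top hM hN (hI.pow (s.sup k))
  have hle : L' ⊓ K ≤ N := by
    refine le_of_cover ?_ (fun U : s ↦ U.1)
      (fun x ↦ by obtain ⟨U, hU, hx⟩ := hs x; exact ⟨⟨U, hU⟩, hx⟩) fun U ↦ ?_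
    · have h := (isQCFamily_sections hL'.localizes).inf hM'
        (isQCFamily_sections hK.localizes)
      rw [← toSubobject_inf hM' h]
      exact localizes_toSubobject hM' h
    · rw [sections_inf hM' hL'.localizes hK.localizes, hKs]
      exact hk U.1 _ (Finset.le_sup U.2)
  have hNL : N ≤ L' := le_iff_sections.2 fun U ↦ le_sup_right.trans (hLs U).ge
  have hNK : N ≤ K := le_iff_sections.2 fun U ↦ le_sup_left.trans (hKs U).ge
  have hLL : L ≤ L' := le_iff_sections.2 fun U ↦ le_sup_left.trans (hLs U).ge
  rcases h L' K hL' hK (le_antisymm hle (le_inf hNL hNK)) with e | e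
  · exact (hLN (e ▸ hLL)).elim
  -- Here `K = N`, that is, `I^m ⊆ N : M`, so every `G`-prime above `N : M` contains `I^m` and
  -- therefore `I`.
  · refine hI.le_gRadical fun P hP hNP ↦ hP.le_of_pow_le (m := s.sup k) hI (le_trans ?_ hNP)
    intro U
    rw [colon_ideal hM hN.localizes]
    intro r hr
    refine Submodule.mem_colon.2 fun m _ ↦ ?_
    rw [← e, hKs]
    exact Submodule.mem_sup_right (Submodule.smul_mem_smul hr trivial)

/-- A chain becomes stationary on each affine open of a finite cover, and the largest of these
indices works globally. -/
lemma wellFoundedGT_cohGSubmodule (hM : IsCoherent M) (Φ : Linearization G X M) :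
    WellFoundedGT {N : Subobject M // IsCohGSubmodule Φ N} := by
  obtain ⟨s, hs⟩ := exists_finite_affine_cover X.left
  rw [wellFoundedGT_iff_monotone_chain_condition]
  intro a
  have hU : ∀ U : X.left.affineOpens, ∃ n, ∀ m, n ≤ m →
      sections (a n).1 U.1 = sections (a m).1 U.1 := by
    intro U
    have := IsLocallyNoetherian.component_noetherian U
    have := finite_sections hM U
    exact WellFoundedGT.monotone_chain_condition
      (⟨fun n ↦ sections (a n).1 U.1, fun n m h ↦ sections_mono (a.2 h) U⟩ :
        ℕ →o Submodule Γ(X.left, U) Γ(M, U))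
  choose n hn using hU
  refine ⟨s.sup n, fun m hm ↦ le_antisymm (a.2 hm) ?_⟩
  refine le_of_cover (a m).2.localizes (fun U : s ↦ U.1)
      (fun x ↦ by obtain ⟨U, hU, hx⟩ := hs x; exact ⟨⟨U, hU⟩, hx⟩) fun U ↦ ?_
  have h := Finset.le_sup (f := n) U.2
  exact (((hn U.1 _ h).symm.trans (hn U.1 _ (h.trans hm))).ge)

/-- Every coherent `G`-submodule is a finite intersection of `G`-primary ones. -/
lemma exists_isGPrimary_decomposition (hG : IsPFlat G X) (hM : IsCoherent M) {N : Subobject M}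
    (hN : IsCohGSubmodule Φ N) :
    ∃ s : Finset (Subobject M), s.inf id = N ∧ ∀ L ∈ s, IsGPrimary Φ L := by
  classical
  have := wellFoundedGT_cohGSubmodule hM Φ
  let _ : SemilatticeInf {N : Subobject M // IsCohGSubmodule Φ N} :=
    Subtype.semilatticeInf (P := IsCohGSubmodule Φ) fun _ _ h h' ↦
      IsCohGSubmodule.inf hG hM h h'
  let _ : OrderTop {N : Subobject M // IsCohGSubmodule Φ N} :=
    Subtype.orderTop (p := IsCohGSubmodule Φ) (isCohGSubmodule_top hM Φ)
  obtain ⟨s, hs, hs'⟩ := exists_infIrred_decomposition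
    (⟨N, hN⟩ : {N : Subobject M // IsCohGSubmodule Φ N})
  refine ⟨s.image Subtype.val, ?_, ?_⟩
  · have key : ∀ s : Finset {N : Subobject M // IsCohGSubmodule Φ N},
        (s.inf id).1 = (s.image Subtype.val).inf id := by
      intro s
      induction s using Finset.induction_on with
      | empty => rfl
      | insert a s _ ih =>
        rw [Finset.inf_insert, Finset.image_insert, Finset.inf_insert, ← ih]
        rfl
    rw [← key, hs]
  · intro L hL
    obtain ⟨L, hLs, rfl⟩ := Finset.mem_image.1 hL
    obtain ⟨hmax, h⟩ := hs' hLs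
    refine isGPrimary_of_irreducible hM L.2 (fun e ↦ hmax ?_)
      fun A B hA hB e ↦ ?_
    -- Irreducible elements are by definition not maximal, which excludes `M` itself.
    · exact fun K _ ↦ show K.1 ≤ L.1 from e ▸ le_top
    exact (h (b := ⟨A, hA⟩) (c := ⟨B, hB⟩) (Subtype.ext e)).imp (congrArg Subtype.val)
      (congrArg Subtype.val)

/-- A decomposition with the least number of components is minimal. -/
lemma exists_minimal_decomposition (hG : IsPFlat G X) (hM : IsCoherent M) {N : Subobject M}
    (hN : IsCohGSubmodule Φ N) :
    ∃ s : Finset (Subobject M), s.inf id = N ∧ (∀ L ∈ s, IsGPrimary Φ L) ∧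
      (∀ L ∈ s, ∀ t : Finset (Subobject M), t ⊂ s → t.inf id ≠ N) ∧
      ∀ L ∈ s, ∀ L' ∈ s, L ≠ L' → gRadical G (colon L) ≠ gRadical G (colon L') := by
  classical
  have hex : ∃ (n : ℕ) (s : Finset (Subobject M)), s.card = n ∧ s.inf id = N ∧
      ∀ L ∈ s, IsGPrimary Φ L := by
    obtain ⟨s, hs⟩ := exists_isGPrimary_decomposition hG hM hN
    exact ⟨_, s, rfl, hs⟩
  obtain ⟨s, hc, hs, hp⟩ := Nat.find_spec hex
  have hmin : ∀ t : Finset (Subobject M), t.card < s.card → t.inf id = N →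
      ¬ ∀ L ∈ t, IsGPrimary Φ L := fun t ht e hp ↦
    Nat.find_min hex (hc ▸ ht) ⟨t, rfl, e, hp⟩
  refine ⟨s, hs, hp, fun L hL t hts e ↦ hmin t (Finset.card_lt_card hts) e fun L hL ↦
    hp L (hts.1 hL), fun L hL L' hL' hne e ↦ ?_⟩
  have hL'' : L' ∈ s.erase L := Finset.mem_erase.2 ⟨hne.symm, hL'⟩
  -- Two components with the same radical are merged into their intersection, which gives a
  -- decomposition with fewer components.
  refine hmin (insert (L ⊓ L') ((s.erase L).erase L')) ?_ ?_ ?_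
  · have h₁ := Finset.card_erase_add_one hL
    have h₂ := Finset.card_erase_add_one hL''
    have h₃ := Finset.card_insert_le (L ⊓ L') ((s.erase L).erase L')
    omega
  · rw [← hs]
    conv_rhs => rw [← Finset.insert_erase hL, ← Finset.insert_erase hL'']
    rw [Finset.inf_insert, Finset.inf_insert, Finset.inf_insert]
    simp only [id, inf_assoc]
  · intro K hK
    rcases Finset.mem_insert.1 hK with rfl | hK
    · exact (hp L hL).inf hG hM (hp L' hL') e
    · exact hp K (Finset.mem_of_mem_erase (Finset.mem_of_mem_erase hK))

end Existence

end GPrimary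

end

/-! ### The decomposition theorem -/

theorem mainTheorem1 {S : Scheme.{u}} (G X : Over S) [GrpObj G] [ModObj G X]
    (hflat : GPrimary.IsPFlat G X) (hX : AlgebraicGeometry.IsNoetherian X.left)
    (M : X.left.Modules) (hM : GPrimary.IsCoherent M) (Φ : GPrimary.Linearization G X M)
    (N : Subobject M) (hN : GPrimary.IsCohGSubmodule Φ N) :
    ∃ (r : ℕ) (D : Fin r → Subobject M),
      GPrimary.IsMinimalGPrimaryDecomposition Φ N D := by
  classical
  obtain ⟨s, hs, hp, hirr, hrad⟩ := GPrimary.exists_minimal_decomposition hflat hM hN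
  have himage : ∀ t : Finset (Fin s.card),
      (t.image fun i ↦ (s.equivFin.symm i : Subobject M)).inf id =
        t.inf fun i ↦ (s.equivFin.symm i : Subobject M) := fun t ↦ by
    rw [Finset.inf_image]
    rfl
  have hinj : Function.Injective fun i ↦ (s.equivFin.symm i : Subobject M) :=
    Subtype.val_injective.comp s.equivFin.symm.injective
  have huniv : (Finset.univ.image fun i ↦ (s.equivFin.symm i : Subobject M)) = s := by
    ext L
    simp only [Finset.mem_image, Finset.mem_univ, true_and]
    exact ⟨by rintro ⟨i, rfl⟩; exact (s.equivFin.symm i).2,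
      fun h ↦ ⟨s.equivFin ⟨L, h⟩, by simp⟩⟩
  refine ⟨s.card, fun i ↦ s.equivFin.symm i, ?_, fun i ↦ hp _ (s.equivFin.symm i).2, ?_, ?_⟩
  · rw [← himage, huniv, hs]
  · intro i
    rw [← himage]
    refine hirr _ (s.equivFin.symm i).2 _ ?_
    -- The enumeration is injective, so omitting an index leaves a proper subset of `s`.
    rw [Finset.image_erase hinj, huniv]
    exact Finset.erase_ssubset (s.equivFin.symm i).2
  · exact fun i j hij ↦ hrad _ (s.equivFin.symm i).2 _ (s.equivFin.symm j).2 (hinj.ne hij)
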